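/- Let $d\ge1$, $\beta>0$, and let $J_{x,y}=J_{y,x}$ ($x,y\in\mathbb Z^d$, $|x-y|=\sum_i|x_i-y_i|=1$) be independent, identically distributed real random variables, indexed by the unordered nearest-neighbour pairs, with $\mathbb E|J_{x,y}|<\infty$. For $L\ge1$ let $\Lambda_L=\{1,\dots,L\}^d$, let $\partial\Lambda_L$ be the set of sites outside $\Lambda_L$ having a neighbour in $\Lambda_L$, and for $\sigma\in\{1,-1\}^{\Lambda_L}$ and $b\in[-1,1]^{\partial\Lambda_L}$ let $$H_L(\sigma;b)=-\sum_{\{x,y\}\subset\Lambda_L,\ |x-y|=1}J_{x,y}\sigma_x\sigma_y-\sum_{x\in\Lambda_L,\ u\in\partial\Lambda_L,\ |x-u|=1}J_{x,u}\sigma_xb_u$$ be the Hamiltonian of the Edwards–Anderson model with zero magnetic field. For $\lambda\in\mathbb R$ put $$H^{(2)}_L(\sigma^1,\sigma^2;\lambda,b)=H_L(\sigma^1;b)+H_L(\sigma^2;b)-\lambda\sum_{x\in\Lambda_L}\sigma^1_x\sigma^2_x,\qquad Z^{(2)}_L(\lambda;b)=\sum_{\sigma^1,\sigma^2}e^{-\beta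 H^{(2)}_L(\sigma^1,\sigma^2;\lambda,b)},$$ let $\langle F\rangle^{(2)}_{L,\lambda;b}=Z^{(2)}_L(\lambda;b)^{-1}\sum_{\sigma^1,\sigma^2}F(\sigma^1,\sigma^2)e^{-\beta H^{(2)}_L(\sigma^1,\sigma^2;\lambda,b)}$, and let $R^{1,2}_L=L^{-d}\sum_{x\in\Lambda_L}\sigma^1_x\sigma^2_x$. Define $$q_{\rm EA}(L)=\mathbb E\max_{b\in[-1,1]^{\partial\Lambda_L}}\langle R^{1,2}_L\rangle^{(2)}_{L,0;b},\qquad q_{\rm br}=\limsup_{L\to\infty}\sqrt{\mathbb E\,\langle (R_L^{1,2})^2\rangle^{(2)}_{L,0;0}}$$ (the latter with the open boundary condition $b=0$), and, for a boundary condition $b_L(\cdot)\in[-1,1]^{\partial\Lambda_L}$ that may depend measurably on the randomness, $$f^{(2)}_L(\lambda;b_L(\cdot))=-\frac1{\beta L^d}\,\mathbb E\log Z^{(2)}_L(\lambda;b_L(\cdot)).$$ Then the limit $q_{\rm EA}=\lim_{L\to\infty}q_{\rm EA}(L)$ exists; for every $\lambda\in\mathbb R$ the limit $f^{(2)}(\lambda)=\lim_{L\to\infty}f^{(2)}_L(\lambda;b_L(\cdot))$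 exists and does not depend on the choice of the boundary conditions $b_L(\cdot)$; the function $f^{(2)}$ has a right derivative at $\lambda=0$, equal to $-q_{\rm EA}$; and $$q_{\rm EA}\ge q_{\rm br}.$$ -/

import Mathlib

open MeasureTheory ProbabilityTheory Filter Topology

namespace EdwardsAnderson

/-- Sites of the `d`-dimensional hypercubic lattice. -/
abbrev Site (d : ℕ) : Type := Fin d → ℤ

/-- The nearest-neighbour graph: `x` and `y` are adjacent iff their `ℓ¹` distance is `1`. -/
def lattice (d : ℕ) : SimpleGraph (Site d) where
  Adj x y := ∑ i, |x i - y i| = 1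
  symm := ⟨fun x y h => by simpa only [abs_sub_comm] using h⟩
  loopless := ⟨fun x h => by simp at h⟩

noncomputable instance (d : ℕ) : DecidableRel (lattice d).Adj :=
  fun x y => inferInstanceAs (Decidable (∑ i, |x i - y i| = 1))

/-- The box `{1, …, L}^d`. -/
noncomputable def box (d L : ℕ) : Finset (Site d) :=
  Fintype.piFinset fun _ => Finset.Icc 1 (L : ℤ)

theorem card_box (d L : ℕ) : (box d L).card = L ^ d := by
  simp [box]

/-- The sites outside `Λ` that are adjacent to a site of `Λ`. (The sites of the intervals
`[x - 1, x + 1]` include all neighbours of `x`; see `mem_boundary`.) -/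
noncomputable def boundary {d : ℕ} (Λ : Finset (Site d)) : Finset (Site d) :=
  (Λ.biUnion fun x => Finset.Icc (x - 1) (x + 1)).filter
    fun u => u ∉ Λ ∧ ∃ x ∈ Λ, (lattice d).Adj x u

theorem mem_boundary {d : ℕ} {Λ : Finset (Site d)} {u : Site d} :
    u ∈ boundary Λ ↔ u ∉ Λ ∧ ∃ x ∈ Λ, (lattice d).Adj x u := by
  simp only [boundary, Finset.mem_filter, Finset.mem_biUnion, Finset.mem_Icc,
    and_iff_right_iff_imp]
  rintro ⟨-, x, hx, hxu⟩
  have key : ∀ i, |x i - u i| ≤ 1 := fun i => by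
    have h : ∑ i, |x i - u i| = 1 := hxu
    rw [← h]
    exact Finset.single_le_sum (f := fun i => |x i - u i|) (fun i _ => abs_nonneg _)
      (Finset.mem_univ i)
  refine ⟨x, hx, fun i => ?_, fun i => ?_⟩
  · have := abs_le.1 (key i)
    simp only [Pi.sub_apply, Pi.one_apply]
    linarith
  · have := abs_le.1 (key i)
    simp only [Pi.add_apply, Pi.one_apply]
    linarith

/-- Ising spin configurations on `Λ`; a spin is an element of `ℤˣ = {1, -1}`. -/
abbrev Config {d : ℕ} (Λ : Finset (Site d)) : Type := Λ → ℤˣ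

/-- The spin at `x`, as a real number. -/
def spin {d : ℕ} {Λ : Finset (Site d)} (σ : Config Λ) (x : Λ) : ℝ := ((σ x : ℤ) : ℝ)

/-- Boundary configurations: a real number in `[-1, 1]` at each boundary site. -/
abbrev BoundaryConfig {d : ℕ} (Λ : Finset (Site d)) : Type :=
  boundary Λ → Set.Icc (-1 : ℝ) 1

/-- The open boundary condition `b = 0`. -/
def openBoundary {d : ℕ} (Λ : Finset (Site d)) : BoundaryConfig Λ :=
  fun _ => ⟨0, by norm_num⟩

/-- The unordered pairs of neighbouring sites of `Λ`. -/
noncomputable def bonds {d : ℕ} (Λ : Finset (Site d)) : Finset (Sym2 Λ) :=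
  Finset.univ.filter fun e => e.map Subtype.val ∈ (lattice d).edgeSet

/-- The pairs `(x, u)` of neighbouring sites with `x` in `Λ` and `u` in its boundary. -/
noncomputable def boundaryBonds {d : ℕ} (Λ : Finset (Site d)) : Finset (Λ × boundary Λ) :=
  Finset.univ.filter fun p => (lattice d).Adj p.1 p.2

/-- The Hamiltonian of the Edwards–Anderson model without magnetic field, for the couplings `j`
(only the values of `j` at nearest-neighbour pairs enter) and the boundary configuration `b`. -/
noncomputable def hamiltonian {d : ℕ} {Λ : Finset (Site d)} (j : Sym2 (Site d) → ℝ)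
    (b : BoundaryConfig Λ) (σ : Config Λ) : ℝ :=
  -(∑ e ∈ bonds Λ, j (e.map Subtype.val) * (e.map (spin σ)).mul)
    - ∑ p ∈ boundaryBonds Λ, j s((p.1 : Site d), (p.2 : Site d)) * spin σ p.1 * (b p.2 : ℝ)

/-- The Hamiltonian of two replicas coupled with strength `lam`. -/
noncomputable def hamiltonian₂ {d : ℕ} {Λ : Finset (Site d)} (lam : ℝ) (j : Sym2 (Site d) → ℝ)
    (b : BoundaryConfig Λ) (σ τ : Config Λ) : ℝ :=
  hamiltonian j b σ + hamiltonian j b τ - lam * ∑ x, spin σ x * spin τ x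

/-- The two-replica partition function. -/
noncomputable def partition₂ {d : ℕ} {Λ : Finset (Site d)} (β lam : ℝ) (j : Sym2 (Site d) → ℝ)
    (b : BoundaryConfig Λ) : ℝ :=
  ∑ σ : Config Λ, ∑ τ : Config Λ, Real.exp (-β * hamiltonian₂ lam j b σ τ)

/-- The two-replica thermal expectation value of `F`. -/
noncomputable def gibbs₂ {d : ℕ} {Λ : Finset (Site d)} (β lam : ℝ) (j : Sym2 (Site d) → ℝ)
    (b : BoundaryConfig Λ) (F : Config Λ → Config Λ → ℝ) : ℝ :=
  (∑ σ : Config Λ, ∑ τ : Config Λ, F σ τ * Real.exp (-β * hamiltonian₂ lam j b σ τ))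
    / partition₂ β lam j b

/-- The replica overlap. -/
noncomputable def overlap {d : ℕ} {Λ : Finset (Site d)} (σ τ : Config Λ) : ℝ :=
  (∑ x, spin σ x * spin τ x) / (Λ.card : ℝ)

/-- The finite-volume order parameter `q_EA(L)`: the average of the maximum of the expected
overlap over all boundary configurations. (The supremum is over a compact space and of a
continuous function, so it is a maximum.) -/
noncomputable def qEAFinite {d : ℕ} {Ω : Type*} [MeasurableSpace Ω] (μ : Measure Ω)
    (J : Sym2 (Site d) → Ω → ℝ) (β : ℝ) (L : ℕ) : ℝ :=
  ∫ ω, ⨆ b : BoundaryConfig (box d L), gibbs₂ β 0 (fun e => J e ω) b overlap ∂μ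

/-- The averaged two-replica free energy density in the box of side `L`, for a boundary
condition `b` that may depend on the realization of the disorder. -/
noncomputable def freeEnergy₂ {d : ℕ} {Ω : Type*} [MeasurableSpace Ω] (μ : Measure Ω)
    (J : Sym2 (Site d) → Ω → ℝ) (β lam : ℝ) (L : ℕ) (b : Ω → BoundaryConfig (box d L)) : ℝ :=
  -(1 / (β * (L : ℝ) ^ d)) *
    ∫ ω, Real.log (partition₂ β lam (fun e => J e ω) (b ω)) ∂μ

/-- The order parameter `q_br` for the broadening of the overlap distribution, under the open
boundary condition. -/
noncomputable def qBr {d : ℕ} {Ω : Type*} [MeasurableSpace Ω] (μ : Measure Ω)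
    (J : Sym2 (Site d) → Ω → ℝ) (β : ℝ) : ℝ :=
  limsup (fun L : ℕ => √(∫ ω, gibbs₂ β 0 (fun e => J e ω) (openBoundary (box d L))
    (fun σ τ => overlap σ τ ^ 2) ∂μ)) atTop

end EdwardsAnderson

open EdwardsAnderson

/-! Give the two replicas separate boundary fields b, c with values in [-1, 1], and let P_a(A) be
the maximum over (b, c) of the logarithm of the partition function with replica coupling a = βλ.
Once the spins of B are fixed, they act on A as a boundary field with values in [-1, 1]; summing out
A first therefore shows that P_a is subadditive on disjoint unions (`maxLogPf_union_le`), and tiling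
a large box gives a limit m(a) of E P_a / L^d. Changing the boundary fields moves log Z by at most
4β times the total coupling across the boundary, whose mean is o(L^d). So all boundary conditions
give the same limit, and the free energy is -m(βλ)/β.

At a = 0 the replicas are independent and the mean unnormalized overlap is Σ m_x(b) m_x(c), which is
at most Q(A) = max_b Σ m_x(b)². Let q_L = E Q / L^d for the box of side L. Jensen's inequality gives
aQ ≤ P_a - P_0 + (boundary term) for a ≥ 0 (`mul_maxOverlap_le`). Conversely P_a - P_0 ≤ R_a, the
maximal log exponential moment of the overlap. R_a is subadditive as well, again by conditioning,
and expanding the exponential in one box of side k gives R_a ≤ aQ + (a k^d)². Hence a q_L - o(1) ≤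
m(a) - m(0) ≤ a q_k + a² k^d whenever a ≥ 0 and a k^d ≤ 1. Taking L → ∞ and then a → 0 forces q_L to
converge to its infimum, and the same inequalities make this limit the right derivative of m at 0
(`exists_tendsto_and_hasDerivWithinAt`).

For the broadening, expand the squared overlap of a large box over pairs of tiles of side k. If no
bond joins two disjoint tiles, conditioning on all other spins factorizes the Gibbs sum, so the mean
product is at most the product of the two values of Q (`wsum_ov_mul_ov_le`); these are independent,
since they involve disjoint sets of bonds. Neighbouring tiles and uncovered sites are negligible as
L → ∞. Thus q_br ≤ q_k for every k ≥ 1, and k → ∞ finishes the proof. -/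

namespace EdwardsAnderson

variable {d : ℕ}

/-! ### Neighbours and the energy of a spin field -/

theorem adj_comm {x u : Site d} : (lattice d).Adj x u ↔ (lattice d).Adj u x :=
  ⟨fun h => h.symm, fun h => h.symm⟩

/-- The neighbours of a site. -/
noncomputable def nbrs (x : Site d) : Finset (Site d) :=
  (Finset.Icc (x - 1) (x + 1)).filter fun u => (lattice d).Adj x u

theorem abs_sub_le_of_adj {x u : Site d} (h : (lattice d).Adj x u) (i : Fin d) :
    |x i - u i| ≤ 1 := by
  have h : ∑ i, |x i - u i| = 1 := h
  rw [← h]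
  exact Finset.single_le_sum (f := fun i => |x i - u i|) (fun i _ => abs_nonneg _)
    (Finset.mem_univ i)

@[simp]
theorem mem_nbrs {x u : Site d} : u ∈ nbrs x ↔ (lattice d).Adj x u := by
  simp only [nbrs, Finset.mem_filter, Finset.mem_Icc, and_iff_right_iff_imp]
  intro hxu
  refine ⟨fun i => ?_, fun i => ?_⟩ <;>
  · have := abs_le.1 (abs_sub_le_of_adj hxu i)
    simp only [Pi.sub_apply, Pi.add_apply, Pi.one_apply]
    linarith

theorem card_nbrs_le (x : Site d) : (nbrs x).card ≤ 3 ^ d := by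
  refine (Finset.card_filter_le _ _).trans ?_
  rw [Pi.card_Icc]
  have h3 : ∀ i : Fin d, (Finset.Icc ((x - 1) i) ((x + 1) i)).card = 3 := fun i => by
    simp only [Pi.sub_apply, Pi.add_apply, Pi.one_apply, Int.card_Icc]
    omega
  rw [Finset.prod_congr rfl fun i _ => h3 i]
  simp

/-- The local field at `x` in the volume `A`; interactions inside `A` are counted by halves. -/
noncomputable def localField (j : Sym2 (Site d) → ℝ) (A : Finset (Site d)) (s b : Site d → ℝ)
    (x : Site d) : ℝ :=
  ∑ u ∈ nbrs x, j s(x, u) * (if u ∈ A then s u / 2 else b u)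

/-- The energy of the spin field `s` in the volume `A` with the boundary field `b`. -/
noncomputable def energy (j : Sym2 (Site d) → ℝ) (A : Finset (Site d)) (s b : Site d → ℝ) : ℝ :=
  -∑ x ∈ A, s x * localField j A s b x

theorem energy_congr {j j' : Sym2 (Site d) → ℝ} {A : Finset (Site d)} {s s' b b' : Site d → ℝ}
    (hs : ∀ x ∈ A, s x = s' x)
    (hj : ∀ x ∈ A, ∀ u, (lattice d).Adj x u → j s(x, u) = j' s(x, u))
    (hb : ∀ x ∈ A, ∀ u, u ∉ A → (lattice d).Adj x u → b u = b' u) :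
    energy j A s b = energy j' A s' b' := by
  unfold energy localField
  congr 1
  refine Finset.sum_congr rfl fun x hx => ?_
  rw [hs x hx]
  congr 1
  refine Finset.sum_congr rfl fun u hu => ?_
  rw [mem_nbrs] at hu
  rw [hj x hx u hu]
  by_cases huA : u ∈ A
  · simp [huA, hs u huA]
  · simp [huA, hb x hx u huA hu]

theorem sum_nbrs_ite_mem (g : Site d → ℝ) (B : Finset (Site d)) (x : Site d) :
    ∑ u ∈ nbrs x, (if u ∈ B then g u else 0)
      = ∑ u ∈ B, if (lattice d).Adj x u then g u else 0 := by
  rw [← Finset.sum_filter, ← Finset.sum_filter]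
  refine Finset.sum_congr ?_ fun _ _ => rfl
  ext u
  simp [and_comm]

/-- Bonds between A and B are charged entirely to A: it sees the spins of B as its boundary field,
while B sees the field zero on A. In the energy of the union each such bond occurs twice, with
weight one half. -/
theorem energy_union {j : Sym2 (Site d) → ℝ} {A B : Finset (Site d)} (h : Disjoint A B)
    (s b : Site d → ℝ) :
    energy j (A ∪ B) s b
      = energy j A s (B.piecewise s b) + energy j B s (A.piecewise 0 b) := by
  have hA : ∀ x, localField j A s (B.piecewise s b) x = localField j (A ∪ B) s b x
      + ∑ u ∈ B, if (lattice d).Adj x u then j s(x, u) * (s u / 2) else 0 := by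
    intro x
    rw [← sum_nbrs_ite_mem (fun u => j s(x, u) * (s u / 2)) B x]
    unfold localField
    rw [← Finset.sum_add_distrib]
    refine Finset.sum_congr rfl fun u _ => ?_
    by_cases h1 : u ∈ A
    · have h2 : u ∉ B := Finset.disjoint_left.1 h h1
      simp [h1, h2]
    · by_cases h2 : u ∈ B <;> simp [h1, h2]
      ring
  have hB : ∀ x, localField j B s (A.piecewise 0 b) x = localField j (A ∪ B) s b x
      - ∑ u ∈ A, if (lattice d).Adj x u then j s(x, u) * (s u / 2) else 0 := by
    intro x
    rw [← sum_nbrs_ite_mem (fun u => j s(x, u) * (s u / 2)) A x]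
    unfold localField
    rw [← Finset.sum_sub_distrib]
    refine Finset.sum_congr rfl fun u _ => ?_
    by_cases h1 : u ∈ A
    · have h2 : u ∉ B := Finset.disjoint_left.1 h h1
      simp [h1, h2]
    · by_cases h2 : u ∈ B <;> simp [h1, h2]
  -- The half shares of the cross bonds have the same sum seen from A and from B, so the share added
  -- for A cancels the one removed for B.
  have hsym : ∑ x ∈ A, s x * ∑ u ∈ B, (if (lattice d).Adj x u then j s(x, u) * (s u / 2) else 0)
      = ∑ x ∈ B, s x * ∑ u ∈ A, (if (lattice d).Adj x u then j s(x, u) * (s u / 2) else 0) := by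
    simp only [Finset.mul_sum]
    rw [Finset.sum_comm]
    refine Finset.sum_congr rfl fun x _ => Finset.sum_congr rfl fun u _ => ?_
    simp only [adj_comm (x := u) (u := x), Sym2.eq_swap (a := u) (b := x)]
    split_ifs <;> ring
  unfold energy
  rw [Finset.sum_union h]
  simp only [hA, hB, mul_add, mul_sub, Finset.sum_add_distrib, Finset.sum_sub_distrib]
  rw [hsym]
  ring

/-! ### Sums over spin configurations -/

/-- The spin field of a configuration, extended by zero. -/
noncomputable def ext {A : Finset (Site d)} (σ : Config A) (x : Site d) : ℝ :=
  if h : x ∈ A then spin σ ⟨x, h⟩ else 0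

/-- The sum over all spin configurations in `A`. -/
noncomputable def tr (A : Finset (Site d)) (f : (Site d → ℝ) → ℝ) : ℝ :=
  ∑ σ : Config A, f (ext σ)

/-- `s` takes the values `±1` on `A` and `0` elsewhere. -/
def IsSpin (A : Finset (Site d)) (s : Site d → ℝ) : Prop :=
  (∀ x ∈ A, s x = 1 ∨ s x = -1) ∧ ∀ x ∉ A, s x = 0

theorem spin_eq {A : Finset (Site d)} (σ : Config A) (x : A) : spin σ x = 1 ∨ spin σ x = -1 := by
  unfold spin
  rcases Int.units_eq_one_or (σ x) with h | h <;> simp [h]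

theorem isSpin_ext {A : Finset (Site d)} (σ : Config A) : IsSpin A (ext σ) := by
  refine ⟨fun x hx => ?_, fun x hx => ?_⟩
  · simpa [ext, hx] using spin_eq σ ⟨x, hx⟩
  · simp [ext, hx]

theorem IsSpin.abs_le {A : Finset (Site d)} {s : Site d → ℝ} (h : IsSpin A s) (x : Site d) :
    |s x| ≤ 1 := by
  by_cases hx : x ∈ A
  · rcases h.1 x hx with h | h <;> simp [h]
  · simp [h.2 x hx]

theorem tr_congr {A : Finset (Site d)} {f g : (Site d → ℝ) → ℝ}
    (h : ∀ s, IsSpin A s → f s = g s) : tr A f = tr A g :=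
  Finset.sum_congr rfl fun σ _ => h _ (isSpin_ext σ)

theorem tr_mono {A : Finset (Site d)} {f g : (Site d → ℝ) → ℝ}
    (h : ∀ s, IsSpin A s → f s ≤ g s) : tr A f ≤ tr A g :=
  Finset.sum_le_sum fun σ _ => h _ (isSpin_ext σ)

theorem tr_pos {A : Finset (Site d)} {f : (Site d → ℝ) → ℝ} (h : ∀ s, 0 < f s) : 0 < tr A f :=
  Finset.sum_pos (fun _ _ => h _) Finset.univ_nonempty

theorem tr_mul_left (A : Finset (Site d)) (c : ℝ) (f : (Site d → ℝ) → ℝ) :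
    tr A (fun s => c * f s) = c * tr A f :=
  (Finset.mul_sum _ _ _).symm

theorem tr_mul_right (A : Finset (Site d)) (c : ℝ) (f : (Site d → ℝ) → ℝ) :
    tr A (fun s => f s * c) = tr A f * c :=
  (Finset.sum_mul _ _ _).symm

theorem tr_add (A : Finset (Site d)) (f g : (Site d → ℝ) → ℝ) :
    tr A (fun s => f s + g s) = tr A f + tr A g :=
  Finset.sum_add_distrib

theorem tr_sum {ι : Type*} (A : Finset (Site d)) (S : Finset ι) (f : ι → (Site d → ℝ) → ℝ) :
    tr A (fun s => ∑ i ∈ S, f i s) = ∑ i ∈ S, tr A (f i) :=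
  Finset.sum_comm

theorem tr_comm (A B : Finset (Site d)) (f : (Site d → ℝ) → (Site d → ℝ) → ℝ) :
    tr A (fun s => tr B (f s)) = tr B fun t => tr A fun s => f s t :=
  Finset.sum_comm

theorem tr_const (A : Finset (Site d)) (c : ℝ) : tr A (fun _ => c) = 2 ^ A.card * c := by
  simp [tr]

theorem ext_piFinsetUnion {A B : Finset (Site d)} (h : Disjoint A B) (σ : Config A)
    (τ : Config B) :
    ext (Equiv.piFinsetUnion (fun _ => ℤˣ) h (σ, τ)) = ext σ + ext τ := by
  funext x
  by_cases h1 : x ∈ A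
  · have h2 : x ∉ B := Finset.disjoint_left.1 h h1
    simp [ext, h1, h2, spin, Equiv.piFinsetUnion_left _ h h1]
  · by_cases h2 : x ∈ B
    · simp [ext, h1, h2, spin, Equiv.piFinsetUnion_right _ h h2]
    · simp [ext, h1, h2]

/-- A configuration on the union is a pair of configurations; as the extensions vanish outside their
volumes, gluing them is addition. -/
theorem tr_union {A B : Finset (Site d)} (h : Disjoint A B) (f : (Site d → ℝ) → ℝ) :
    tr (A ∪ B) f = tr B fun t => tr A fun s => f (s + t) := by
  rw [tr_comm]
  unfold tr
  rw [← Fintype.sum_prod_type', ← (Equiv.piFinsetUnion (fun _ => ℤˣ) h).sum_comp]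
  refine Finset.sum_congr rfl fun p _ => ?_
  change _ = f (ext p.1 + ext p.2)
  rw [← ext_piFinsetUnion h]

/-- The sum over pairs of spin configurations. -/
noncomputable def tr₂ (A : Finset (Site d)) (G : (Site d → ℝ) → (Site d → ℝ) → ℝ) : ℝ :=
  tr A fun s => tr A fun t => G s t

theorem tr₂_congr {A : Finset (Site d)} {f g : (Site d → ℝ) → (Site d → ℝ) → ℝ}
    (h : ∀ s t, IsSpin A s → IsSpin A t → f s t = g s t) : tr₂ A f = tr₂ A g :=
  tr_congr fun s hs => tr_congr fun t ht => h s t hs ht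

theorem tr₂_mono {A : Finset (Site d)} {f g : (Site d → ℝ) → (Site d → ℝ) → ℝ}
    (h : ∀ s t, IsSpin A s → IsSpin A t → f s t ≤ g s t) : tr₂ A f ≤ tr₂ A g :=
  tr_mono fun s hs => tr_mono fun t ht => h s t hs ht

theorem tr₂_pos {A : Finset (Site d)} {f : (Site d → ℝ) → (Site d → ℝ) → ℝ}
    (h : ∀ s t, 0 < f s t) : 0 < tr₂ A f :=
  tr_pos fun s => tr_pos fun t => h s t

theorem tr₂_mul_left (A : Finset (Site d)) (c : ℝ) (f : (Site d → ℝ) → (Site d → ℝ) → ℝ) :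
    tr₂ A (fun s t => c * f s t) = c * tr₂ A f := by
  simp only [tr₂, tr_mul_left]

theorem tr₂_add (A : Finset (Site d)) (f g : (Site d → ℝ) → (Site d → ℝ) → ℝ) :
    tr₂ A (fun s t => f s t + g s t) = tr₂ A f + tr₂ A g := by
  simp only [tr₂, tr_add]

theorem tr₂_sum {ι : Type*} (A : Finset (Site d)) (S : Finset ι)
    (f : ι → (Site d → ℝ) → (Site d → ℝ) → ℝ) :
    tr₂ A (fun s t => ∑ i ∈ S, f i s t) = ∑ i ∈ S, tr₂ A (f i) := by
  simp only [tr₂, tr_sum]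

theorem tr₂_const (A : Finset (Site d)) (c : ℝ) :
    tr₂ A (fun _ _ => c) = (2 ^ A.card * 2 ^ A.card) * c := by
  simp only [tr₂, tr_const]
  ring

theorem tr₂_mul (A : Finset (Site d)) (f g : (Site d → ℝ) → ℝ) :
    tr₂ A (fun s t => f s * g t) = tr A f * tr A g := by
  simp only [tr₂, tr_mul_left, tr_mul_right]

theorem tr₂_union {A B : Finset (Site d)} (h : Disjoint A B)
    (G : (Site d → ℝ) → (Site d → ℝ) → ℝ) :
    tr₂ (A ∪ B) G = tr₂ B fun s' t' => tr₂ A fun s t => G (s + s') (t + t') := by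
  unfold tr₂
  rw [tr_union h]
  refine tr_congr fun s' _ => ?_
  rw [tr_comm B A]
  exact tr_congr fun s _ => tr_union h _

/-! ### Gibbs sums and conditioning on part of the volume -/

/-- The Boltzmann weight of a spin field. -/
noncomputable def bw (β : ℝ) (j : Sym2 (Site d) → ℝ) (A : Finset (Site d)) (s b : Site d → ℝ) : ℝ :=
  Real.exp (-β * energy j A s b)

theorem bw_pos (β : ℝ) (j : Sym2 (Site d) → ℝ) (A : Finset (Site d)) (s b : Site d → ℝ) :
    0 < bw β j A s b := Real.exp_pos _

/-- The unnormalized Gibbs sum of `G` over two replicas with boundary fields `b` and `c`. -/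
noncomputable def wsum (β : ℝ) (j : Sym2 (Site d) → ℝ) (A : Finset (Site d)) (b c : Site d → ℝ)
    (G : (Site d → ℝ) → (Site d → ℝ) → ℝ) : ℝ :=
  tr₂ A fun s t => G s t * (bw β j A s b * bw β j A t c)

/-- The unnormalized overlap in `A`. -/
noncomputable def ov (A : Finset (Site d)) (s t : Site d → ℝ) : ℝ := ∑ x ∈ A, s x * t x

/-- `F` depends only on the restrictions of its arguments to `A`. -/
def IsLocal (A : Finset (Site d)) (F : (Site d → ℝ) → (Site d → ℝ) → ℝ) : Prop :=
  ∀ s s' t t' : Site d → ℝ, (∀ x ∈ A, s x = s' x) → (∀ x ∈ A, t x = t' x) → F s t = F s' t'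

theorem isLocal_ov (A : Finset (Site d)) : IsLocal A (ov A) := fun s s' t t' hs ht =>
  Finset.sum_congr rfl fun x hx => by rw [hs x hx, ht x hx]

theorem isLocal_const (A : Finset (Site d)) (r : ℝ) : IsLocal A fun _ _ => r :=
  fun _ _ _ _ _ _ => rfl

theorem IsLocal.comp {A : Finset (Site d)} {F : (Site d → ℝ) → (Site d → ℝ) → ℝ}
    (h : IsLocal A F) (g : ℝ → ℝ) : IsLocal A fun s t => g (F s t) :=
  fun s s' t t' hs ht => by
    beta_reduce; rw [h s s' t t' hs ht]

theorem IsLocal.mul {A : Finset (Site d)} {F G : (Site d → ℝ) → (Site d → ℝ) → ℝ}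
    (hF : IsLocal A F) (hG : IsLocal A G) : IsLocal A fun s t => F s t * G s t :=
  fun s s' t t' hs ht => by
    beta_reduce; rw [hF s s' t t' hs ht, hG s s' t t' hs ht]

theorem IsLocal.mono {A B : Finset (Site d)} {F : (Site d → ℝ) → (Site d → ℝ) → ℝ}
    (h : IsLocal A F) (hAB : A ⊆ B) : IsLocal B F :=
  fun s s' t t' hs ht => h s s' t t' (fun x hx => hs x (hAB hx)) fun x hx => ht x (hAB hx)

/-- A boundary field takes values in `[-1, 1]`. -/
def IsBC (b : Site d → ℝ) : Prop := ∀ u, |b u| ≤ 1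

theorem isBC_zero : IsBC (0 : Site d → ℝ) := fun _ => by simp

theorem IsSpin.isBC {A : Finset (Site d)} {s : Site d → ℝ} (h : IsSpin A s) : IsBC s := h.abs_le

theorem IsBC.piecewise {b c : Site d → ℝ} (hb : IsBC b) (hc : IsBC c) (A : Finset (Site d)) :
    IsBC (A.piecewise b c) := fun u => by
  by_cases h : u ∈ A <;> simp [h, hb u, hc u]

theorem bw_union (β : ℝ) (j : Sym2 (Site d) → ℝ) {A B : Finset (Site d)} (h : Disjoint A B)
    {s s' : Site d → ℝ} (hs : ∀ x ∉ A, s x = 0) (hs' : ∀ x ∉ B, s' x = 0) (b : Site d → ℝ) :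
    bw β j (A ∪ B) (s + s') b
      = bw β j A s (B.piecewise s' b) * bw β j B s' (A.piecewise 0 b) := by
  have hA : ∀ x ∈ A, s' x = 0 := fun x hx => hs' x (Finset.disjoint_left.1 h hx)
  have hB : ∀ x ∈ B, s x = 0 := fun x hx => hs x (Finset.disjoint_right.1 h hx)
  unfold bw
  rw [← Real.exp_add, ← mul_add, energy_union h]
  congr 3
  · refine energy_congr (fun x hx => by simp [hA x hx]) (fun _ _ _ _ => rfl) fun x hx u hu _ => ?_
    by_cases huB : u ∈ B <;> simp [huB, hs u hu]
  · exact energy_congr (fun x hx => by simp [hB x hx]) (fun _ _ _ _ => rfl) fun _ _ _ _ _ => rfl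

/-- The Markov property in unnormalized form: with the spins of B frozen, A is a system with these
spins as boundary field. The replicas freeze different spins, which is why each carries its own
boundary field. -/
theorem wsum_union (β : ℝ) (j : Sym2 (Site d) → ℝ) {A B : Finset (Site d)} (h : Disjoint A B)
    {F G : (Site d → ℝ) → (Site d → ℝ) → ℝ} (hF : IsLocal A F) (hG : IsLocal B G)
    (b c : Site d → ℝ) :
    wsum β j (A ∪ B) b c (fun s t => F s t * G s t)
      = wsum β j B (A.piecewise 0 b) (A.piecewise 0 c)
          fun s' t' => G s' t' * wsum β j A (B.piecewise s' b) (B.piecewise t' c) F := by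
  unfold wsum
  rw [tr₂_union h]
  refine tr₂_congr fun s' t' hs' ht' => ?_
  rw [mul_right_comm, ← tr₂_mul_left]
  refine tr₂_congr fun s t hs ht => ?_
  rw [bw_union β j h hs.2 hs'.2, bw_union β j h ht.2 ht'.2]
  have e1 : ∀ x ∈ A, ∀ r : Site d → ℝ, IsSpin B r → r x = 0 :=
    fun x hx r hr => hr.2 x (Finset.disjoint_left.1 h hx)
  have e2 : ∀ x ∈ B, ∀ r : Site d → ℝ, IsSpin A r → r x = 0 :=
    fun x hx r hr => hr.2 x (Finset.disjoint_right.1 h hx)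
  beta_reduce
  rw [hF (s + s') s (t + t') t (fun x hx => by simp [e1 x hx s' hs'])
      fun x hx => by simp [e1 x hx t' ht'],
    hG (s + s') s' (t + t') t' (fun x hx => by simp [e2 x hx s hs])
      fun x hx => by simp [e2 x hx t ht]]
  ring

theorem wsum_pos (β : ℝ) (j : Sym2 (Site d) → ℝ) (A : Finset (Site d)) (b c : Site d → ℝ)
    {G : (Site d → ℝ) → (Site d → ℝ) → ℝ} (hG : ∀ s t, 0 < G s t) : 0 < wsum β j A b c G :=
  tr₂_pos fun s t => mul_pos (hG s t) (mul_pos (bw_pos ..) (bw_pos ..))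

theorem wsum_mono (β : ℝ) (j : Sym2 (Site d) → ℝ) (A : Finset (Site d)) (b c : Site d → ℝ)
    {F G : (Site d → ℝ) → (Site d → ℝ) → ℝ}
    (h : ∀ s t, IsSpin A s → IsSpin A t → F s t ≤ G s t) :
    wsum β j A b c F ≤ wsum β j A b c G :=
  tr₂_mono fun s t hs ht =>
    mul_le_mul_of_nonneg_right (h s t hs ht) (mul_pos (bw_pos ..) (bw_pos ..)).le

theorem wsum_mul_left (β : ℝ) (j : Sym2 (Site d) → ℝ) (A : Finset (Site d)) (b c : Site d → ℝ)
    (r : ℝ) (G : (Site d → ℝ) → (Site d → ℝ) → ℝ) :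
    wsum β j A b c (fun s t => r * G s t) = r * wsum β j A b c G := by
  simp only [wsum, mul_assoc, tr₂_mul_left]

theorem wsum_add (β : ℝ) (j : Sym2 (Site d) → ℝ) (A : Finset (Site d)) (b c : Site d → ℝ)
    (F G : (Site d → ℝ) → (Site d → ℝ) → ℝ) :
    wsum β j A b c (fun s t => F s t + G s t) = wsum β j A b c F + wsum β j A b c G := by
  simp only [wsum, add_mul, tr₂_add]

theorem wsum_sum {ι : Type*} (S : Finset ι) (β : ℝ) (j : Sym2 (Site d) → ℝ) (A : Finset (Site d))
    (b c : Site d → ℝ) (F : ι → (Site d → ℝ) → (Site d → ℝ) → ℝ) :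
    wsum β j A b c (fun s t => ∑ i ∈ S, F i s t) = ∑ i ∈ S, wsum β j A b c (F i) := by
  simp only [wsum, Finset.sum_mul, tr₂_sum]

/-- A bound that is uniform in the boundary fields of A can be applied conditionally on the spins of
B, and the nonnegative weight G preserves it. -/
theorem wsum_union_le (β : ℝ) (j : Sym2 (Site d) → ℝ) {A B : Finset (Site d)} (h : Disjoint A B)
    {F F' G : (Site d → ℝ) → (Site d → ℝ) → ℝ} (hF : IsLocal A F) (hF' : IsLocal A F')
    (hG : IsLocal B G) (hG0 : ∀ s t, 0 ≤ G s t) {K : ℝ}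
    (hK : ∀ b c, IsBC b → IsBC c → wsum β j A b c F ≤ K * wsum β j A b c F')
    {b c : Site d → ℝ} (hb : IsBC b) (hc : IsBC c) :
    wsum β j (A ∪ B) b c (fun s t => F s t * G s t)
      ≤ K * wsum β j (A ∪ B) b c fun s t => F' s t * G s t := by
  rw [wsum_union β j h hF hG, wsum_union β j h hF' hG, ← wsum_mul_left]
  refine wsum_mono _ _ _ _ _ fun s t hs ht => ?_
  rw [mul_left_comm]
  exact mul_le_mul_of_nonneg_left (hK _ _ (hs.isBC.piecewise hb _) (ht.isBC.piecewise hc _))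
    (hG0 s t)

/-! ### Submultiplicativity of partition functions and exponential moments -/

/-- The two-replica partition function with coupling `a` and boundary fields `b` and `c`. -/
noncomputable def pf (β a : ℝ) (j : Sym2 (Site d) → ℝ) (A : Finset (Site d))
    (b c : Site d → ℝ) : ℝ :=
  wsum β j A b c fun s t => Real.exp (a * ov A s t)

theorem pf_pos (β a : ℝ) (j : Sym2 (Site d) → ℝ) (A : Finset (Site d)) (b c : Site d → ℝ) :
    0 < pf β a j A b c := wsum_pos _ _ _ _ _ fun _ _ => Real.exp_pos _

theorem pf_zero (β : ℝ) (j : Sym2 (Site d) → ℝ) (A : Finset (Site d)) (b c : Site d → ℝ) :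
    pf β 0 j A b c = wsum β j A b c fun _ _ => 1 := by
  simp [pf]

theorem exp_ov_union (a : ℝ) {A B : Finset (Site d)} (h : Disjoint A B) (s t : Site d → ℝ) :
    Real.exp (a * ov (A ∪ B) s t) = Real.exp (a * ov A s t) * Real.exp (a * ov B s t) := by
  rw [← Real.exp_add, ← mul_add, ov, Finset.sum_union h]; rfl

theorem isLocal_exp_ov (a : ℝ) (A : Finset (Site d)) :
    IsLocal A fun s t => Real.exp (a * ov A s t) :=
  (isLocal_ov A).comp fun r => Real.exp (a * r)

theorem pf_union_le (β a : ℝ) (j : Sym2 (Site d) → ℝ) {A B : Finset (Site d)} (h : Disjoint A B)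
    {K K' : ℝ} (hK : ∀ b c, IsBC b → IsBC c → pf β a j A b c ≤ K)
    (hK' : ∀ b c, IsBC b → IsBC c → pf β a j B b c ≤ K')
    {b c : Site d → ℝ} (hb : IsBC b) (hc : IsBC c) : pf β a j (A ∪ B) b c ≤ K * K' := by
  have hK0 : 0 ≤ K := (pf_pos β a j A 0 0).le.trans (hK 0 0 isBC_zero isBC_zero)
  calc pf β a j (A ∪ B) b c
      = wsum β j (A ∪ B) b c fun s t => Real.exp (a * ov A s t) * Real.exp (a * ov B s t) := by
        simp only [pf, exp_ov_union a h]
    _ ≤ K * pf β a j B (A.piecewise 0 b) (A.piecewise 0 c) := by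
        rw [wsum_union β j h (isLocal_exp_ov a A) (isLocal_exp_ov a B), pf, ← wsum_mul_left]
        refine wsum_mono _ _ _ _ _ fun s t hs ht => ?_
        rw [mul_comm]
        exact mul_le_mul_of_nonneg_right
          (hK _ _ (hs.isBC.piecewise hb _) (ht.isBC.piecewise hc _)) (Real.exp_pos _).le
    _ ≤ K * K' := mul_le_mul_of_nonneg_left
        (hK' _ _ (isBC_zero.piecewise hb _) (isBC_zero.piecewise hc _)) hK0

theorem pf_union_le_mul_pf_zero (β a : ℝ) (j : Sym2 (Site d) → ℝ) {A B : Finset (Site d)}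
    (h : Disjoint A B) {K K' : ℝ}
    (hK : ∀ b c, IsBC b → IsBC c → pf β a j A b c ≤ K * pf β 0 j A b c)
    (hK' : ∀ b c, IsBC b → IsBC c → pf β a j B b c ≤ K' * pf β 0 j B b c)
    {b c : Site d → ℝ} (hb : IsBC b) (hc : IsBC c) :
    pf β a j (A ∪ B) b c ≤ K * K' * pf β 0 j (A ∪ B) b c := by
  have hK0 : 0 ≤ K := by
    have := (pf_pos β a j A 0 0).le.trans (hK 0 0 isBC_zero isBC_zero)
    exact nonneg_of_mul_nonneg_left this (pf_pos ..)
  simp only [pf_zero] at *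
  calc pf β a j (A ∪ B) b c
      = wsum β j (A ∪ B) b c fun s t => Real.exp (a * ov A s t) * Real.exp (a * ov B s t) := by
        simp only [pf, exp_ov_union a h]
    _ ≤ K * wsum β j (A ∪ B) b c fun s t => 1 * Real.exp (a * ov B s t) :=
        wsum_union_le β j h (isLocal_exp_ov a A) (isLocal_const A 1) (isLocal_exp_ov a B)
          (fun _ _ => (Real.exp_pos _).le) hK hb hc
    -- The exponential on A is gone; the same argument now runs with A and B exchanged and the
    -- trivial weight 1 on A.
    _ = K * wsum β j (B ∪ A) b c fun s t => Real.exp (a * ov B s t) * 1 := by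
        rw [Finset.union_comm]; simp only [one_mul, mul_one]
    _ ≤ K * (K' * wsum β j (B ∪ A) b c fun _ _ => 1 * 1) :=
        mul_le_mul_of_nonneg_left (wsum_union_le β j h.symm (isLocal_exp_ov a B)
          (isLocal_const B 1) (isLocal_const A 1) (fun _ _ => zero_le_one) hK' hb hc) hK0
    _ = _ := by rw [Finset.union_comm, mul_one, mul_assoc]

/-! ### Magnetizations and a priori bounds -/

/-- The local magnetization. -/
noncomputable def mag (β : ℝ) (j : Sym2 (Site d) → ℝ) (A : Finset (Site d)) (b : Site d → ℝ)
    (x : Site d) : ℝ :=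
  tr A (fun s => s x * bw β j A s b) / tr A fun s => bw β j A s b

theorem tr_bw_pos (β : ℝ) (j : Sym2 (Site d) → ℝ) (A : Finset (Site d)) (b : Site d → ℝ) :
    0 < tr A fun s => bw β j A s b := tr_pos fun _ => bw_pos ..

theorem abs_mag_le (β : ℝ) (j : Sym2 (Site d) → ℝ) (A : Finset (Site d)) (b : Site d → ℝ)
    (x : Site d) : |mag β j A b x| ≤ 1 := by
  have hp := tr_bw_pos β j A b
  rw [mag, abs_div, abs_of_pos hp, div_le_one hp, abs_le, neg_le, ← neg_one_mul, ← tr_mul_left]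
  constructor <;>
  · refine tr_mono fun s hs => ?_
    have := abs_le.1 (hs.abs_le x)
    nlinarith [bw_pos β j A s b]

theorem wsum_one (β : ℝ) (j : Sym2 (Site d) → ℝ) (A : Finset (Site d)) (b c : Site d → ℝ) :
    wsum β j A b c (fun _ _ => 1)
      = (tr A fun s => bw β j A s b) * tr A fun s => bw β j A s c := by
  simp only [wsum, one_mul, tr₂_mul A (fun s => bw β j A s b) fun t => bw β j A t c]

/-- Without coupling the replicas are independent, so the mean of each product of two spins
factorizes into magnetizations, also for different boundary fields. -/
theorem wsum_ov (β : ℝ) (j : Sym2 (Site d) → ℝ) (A : Finset (Site d)) (b c : Site d → ℝ) :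
    wsum β j A b c (ov A)
      = (∑ x ∈ A, mag β j A b x * mag β j A c x) * wsum β j A b c fun _ _ => 1 := by
  have hb := (tr_bw_pos β j A b).ne'
  have hc := (tr_bw_pos β j A c).ne'
  rw [wsum_one]
  unfold ov
  rw [wsum_sum, Finset.sum_mul]
  refine Finset.sum_congr rfl fun x _ => ?_
  have : wsum β j A b c (fun s t => s x * t x)
      = tr A (fun s => s x * bw β j A s b) * tr A fun s => s x * bw β j A s c := by
    rw [← tr₂_mul A (fun s => s x * bw β j A s b) fun t => t x * bw β j A t c]
    exact tr₂_congr fun s t _ _ => by ring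
  rw [this, mag, mag]
  field_simp

theorem abs_ov_le {A : Finset (Site d)} {s t : Site d → ℝ} (hs : IsBC s) (ht : IsBC t) :
    |ov A s t| ≤ A.card := by
  refine (Finset.abs_sum_le_sum_abs _ _).trans ?_
  rw [← nsmul_one, ← Finset.sum_const]
  refine Finset.sum_le_sum fun x _ => ?_
  rw [abs_mul]
  exact mul_le_one₀ (hs x) (abs_nonneg _) (ht x)

/-- The total strength of the couplings at the sites of `A`. -/
noncomputable def totalCoupling (j : Sym2 (Site d) → ℝ) (A : Finset (Site d)) : ℝ :=
  ∑ x ∈ A, ∑ u ∈ nbrs x, |j s(x, u)|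

/-- The total strength of the couplings between `A` and its complement. -/
noncomputable def boundaryCoupling (j : Sym2 (Site d) → ℝ) (A : Finset (Site d)) : ℝ :=
  ∑ x ∈ A, ∑ u ∈ nbrs x with u ∉ A, |j s(x, u)|

theorem abs_energy_le (j : Sym2 (Site d) → ℝ) (A : Finset (Site d)) {s b : Site d → ℝ}
    (hs : IsBC s) (hb : IsBC b) : |energy j A s b| ≤ totalCoupling j A := by
  rw [energy, abs_neg]
  refine (Finset.abs_sum_le_sum_abs _ _).trans (Finset.sum_le_sum fun x _ => ?_)
  rw [abs_mul]
  refine (mul_le_of_le_one_left (abs_nonneg _) (hs x)).trans ?_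
  refine (Finset.abs_sum_le_sum_abs _ _).trans (Finset.sum_le_sum fun u _ => ?_)
  rw [abs_mul]
  refine mul_le_of_le_one_right (abs_nonneg _) ?_
  split_ifs
  · rw [abs_div, abs_two]
    linarith [hs u]
  · exact hb u

/-- Only bonds leaving A feel the boundary field, and two fields differ by at most 2 at each site.
-/
theorem energy_sub_le (j : Sym2 (Site d) → ℝ) (A : Finset (Site d)) {s b c : Site d → ℝ}
    (hs : IsBC s) (hb : IsBC b) (hc : IsBC c) :
    energy j A s b - energy j A s c ≤ 2 * boundaryCoupling j A := by
  refine (le_abs_self _).trans ?_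
  have : energy j A s b - energy j A s c
      = ∑ x ∈ A, s x * ∑ u ∈ nbrs x with u ∉ A, j s(x, u) * (c u - b u) := by
    unfold energy localField
    rw [neg_sub_neg, ← Finset.sum_sub_distrib]
    refine Finset.sum_congr rfl fun x _ => ?_
    rw [← mul_sub, ← Finset.sum_sub_distrib, Finset.sum_filter]
    congr 1
    refine Finset.sum_congr rfl fun u _ => ?_
    by_cases h : u ∈ A <;> simp [h, mul_sub]
  rw [this, boundaryCoupling, Finset.mul_sum]
  refine (Finset.abs_sum_le_sum_abs _ _).trans (Finset.sum_le_sum fun x _ => ?_)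
  rw [abs_mul, Finset.mul_sum]
  refine (mul_le_of_le_one_left (abs_nonneg _) (hs x)).trans ?_
  refine (Finset.abs_sum_le_sum_abs _ _).trans (Finset.sum_le_sum fun u _ => ?_)
  rw [abs_mul, mul_comm]
  refine mul_le_mul_of_nonneg_right ?_ (abs_nonneg _)
  rw [abs_le]
  have := abs_le.1 (hb u)
  have := abs_le.1 (hc u)
  constructor <;> linarith

/-- The constant 4β is 2β from `energy_sub_le` for each of the two replicas. -/
theorem pf_le_exp_mul_pf {β : ℝ} (hβ : 0 ≤ β) (a : ℝ) (j : Sym2 (Site d) → ℝ)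
    (A : Finset (Site d)) {b c b' c' : Site d → ℝ} (hb : IsBC b) (hc : IsBC c) (hb' : IsBC b')
    (hc' : IsBC c') :
    pf β a j A b c ≤ Real.exp (4 * β * boundaryCoupling j A) * pf β a j A b' c' := by
  unfold pf wsum
  rw [← tr₂_mul_left]
  refine tr₂_mono fun s t hs ht => ?_
  beta_reduce
  rw [mul_left_comm (Real.exp (4 * β * _))]
  refine mul_le_mul_of_nonneg_left ?_ (Real.exp_pos _).le
  unfold bw
  rw [← Real.exp_add, ← Real.exp_add, ← Real.exp_add, Real.exp_le_exp]
  have h1 := mul_le_mul_of_nonneg_left (energy_sub_le j A hs.isBC hb' hb) hβ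
  have h2 := mul_le_mul_of_nonneg_left (energy_sub_le j A ht.isBC hc' hc) hβ
  linarith

theorem log_pf_sub_le {β : ℝ} (hβ : 0 ≤ β) (a : ℝ) (j : Sym2 (Site d) → ℝ)
    (A : Finset (Site d)) {b c b' c' : Site d → ℝ} (hb : IsBC b) (hc : IsBC c) (hb' : IsBC b')
    (hc' : IsBC c') :
    Real.log (pf β a j A b c)
      ≤ Real.log (pf β a j A b' c') + 4 * β * boundaryCoupling j A := by
  have := Real.log_le_log (pf_pos ..) (pf_le_exp_mul_pf hβ a j A hb hc hb' hc')
  rw [Real.log_mul (Real.exp_pos _).ne' (pf_pos ..).ne', Real.log_exp] at this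
  linarith

theorem abs_log_pf_le {β : ℝ} (hβ : 0 ≤ β) (a : ℝ) (j : Sym2 (Site d) → ℝ)
    (A : Finset (Site d)) {b c : Site d → ℝ} (hb : IsBC b) (hc : IsBC c) :
    |Real.log (pf β a j A b c)|
      ≤ (|a| + 2 * Real.log 2) * A.card + 2 * β * totalCoupling j A := by
  -- X bounds the exponent of every term; there are 4^|A| terms, whence the 2 log 2 per site.
  set X := |a| * A.card + 2 * β * totalCoupling j A with hX
  have key : ∀ s t : Site d → ℝ, IsSpin A s → IsSpin A t →
      |a * ov A s t + (-β * energy j A s b + -β * energy j A t c)| ≤ X := by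
    intro s t hs ht
    have h1 : |a * ov A s t| ≤ |a| * A.card := by
      rw [abs_mul]
      exact mul_le_mul_of_nonneg_left (abs_ov_le hs.isBC ht.isBC) (abs_nonneg _)
    have h2 : ∀ (r e : Site d → ℝ), IsSpin A r → IsBC e →
        |-β * energy j A r e| ≤ β * totalCoupling j A := by
      intro r e hr he
      rw [abs_mul, abs_neg, abs_of_nonneg hβ]
      exact mul_le_mul_of_nonneg_left (abs_energy_le j A hr.isBC he) hβ
    have h3 := abs_add_le (a * ov A s t) (-β * energy j A s b + -β * energy j A t c)
    have h4 := abs_add_le (-β * energy j A s b) (-β * energy j A t c)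
    linarith [h2 s b hs hb, h2 t c ht hc]
  have hlog2 : 0 ≤ Real.log 2 := Real.log_nonneg (by norm_num)
  have hup : pf β a j A b c ≤ 2 ^ A.card * 2 ^ A.card * Real.exp X := by
    rw [← tr₂_const, pf, wsum]
    refine tr₂_mono fun s t hs ht => ?_
    unfold bw
    rw [← Real.exp_add, ← Real.exp_add, Real.exp_le_exp]
    exact (abs_le.1 (key s t hs ht)).2
  have hlo : 2 ^ A.card * 2 ^ A.card * Real.exp (-X) ≤ pf β a j A b c := by
    rw [← tr₂_const, pf, wsum]
    refine tr₂_mono fun s t hs ht => ?_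
    unfold bw
    rw [← Real.exp_add, ← Real.exp_add, Real.exp_le_exp]
    exact (abs_le.1 (key s t hs ht)).1
  have hup' := Real.log_le_log (pf_pos ..) hup
  have hlo' := Real.log_le_log (by positivity) hlo
  rw [Real.log_mul (by positivity) (by positivity), Real.log_mul (by positivity) (by positivity),
    Real.log_exp, Real.log_pow] at hup' hlo'
  rw [abs_le]
  have : 0 ≤ (A.card : ℝ) * Real.log 2 := by positivity
  constructor <;> nlinarith

theorem pf_le_exp_mul_pf_zero (β a : ℝ) (j : Sym2 (Site d) → ℝ) (A : Finset (Site d))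
    (b c : Site d → ℝ) : pf β a j A b c ≤ Real.exp (|a| * A.card) * pf β 0 j A b c := by
  rw [pf_zero, ← wsum_mul_left]
  refine wsum_mono _ _ _ _ _ fun s t hs ht => ?_
  rw [mul_one, Real.exp_le_exp]
  refine (le_abs_self _).trans ?_
  rw [abs_mul]
  exact mul_le_mul_of_nonneg_left (abs_ov_le hs.isBC ht.isBC) (abs_nonneg _)

theorem exp_mul_pf_zero_le_pf (β a : ℝ) (j : Sym2 (Site d) → ℝ) (A : Finset (Site d))
    (b c : Site d → ℝ) : Real.exp (-(|a| * A.card)) * pf β 0 j A b c ≤ pf β a j A b c := by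
  rw [pf_zero, ← wsum_mul_left]
  refine wsum_mono _ _ _ _ _ fun s t hs ht => ?_
  rw [mul_one, Real.exp_le_exp]
  refine neg_le_of_abs_le ?_
  rw [abs_mul]
  exact mul_le_mul_of_nonneg_left (abs_ov_le hs.isBC ht.isBC) (abs_nonneg _)

theorem abs_log_pf_div_le (β a : ℝ) (j : Sym2 (Site d) → ℝ) (A : Finset (Site d))
    (b c : Site d → ℝ) :
    |Real.log (pf β a j A b c / pf β 0 j A b c)| ≤ |a| * A.card := by
  have h0 := pf_pos β 0 j A b c
  have ha := pf_pos β a j A b c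
  rw [abs_le, Real.le_log_iff_exp_le (div_pos ha h0), Real.log_le_iff_le_exp (div_pos ha h0),
    le_div_iff₀ h0, div_le_iff₀ h0]
  exact ⟨exp_mul_pf_zero_le_pf .., pf_le_exp_mul_pf_zero ..⟩

/-! ### Boundary fields, measurability and continuity -/

/-- Boundary fields on the whole lattice. -/
abbrev Field (d : ℕ) : Type := Site d → Set.Icc (-1 : ℝ) 1

instance : Nonempty (Field d) := ⟨fun _ => ⟨0, by norm_num⟩⟩

/-- The real-valued function underlying a boundary field. -/
def Field.val (b : Field d) : Site d → ℝ := fun u => (b u : ℝ)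

theorem Field.isBC (b : Field d) : IsBC b.val := fun u => abs_le.2 (b u).2

theorem IsBC.exists_field {b : Site d → ℝ} (hb : IsBC b) : ∃ b' : Field d, b'.val = b :=
  ⟨fun u => ⟨b u, abs_le.1 (hb u)⟩, rfl⟩

/-- By continuity the supremum may be taken over a countable dense set. -/
theorem measurable_iSup_of_continuous {P T : Type*} [TopologicalSpace P]
    [TopologicalSpace.SeparableSpace P] [MeasurableSpace T] {f : T → P → ℝ}
    (hm : ∀ p, Measurable fun x => f x p) (hc : ∀ x, Continuous (f x)) :
    Measurable fun x => ⨆ p, f x p := by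
  obtain ⟨S, hS, hSd⟩ := TopologicalSpace.exists_countable_dense P
  have := hS.to_subtype
  simp_rw [← fun x => hSd.ciSup' (hc x)]
  exact Measurable.iSup fun p => hm p

section Regularity

theorem measurable_energy {T : Type*} [MeasurableSpace T] {j : T → Sym2 (Site d) → ℝ}
    {b : T → Site d → ℝ} (hj : Measurable j) (hb : Measurable b) (A : Finset (Site d))
    (s : Site d → ℝ) : Measurable fun x => energy (j x) A s (b x) := by
  unfold energy localField
  have hj' := fun e => (measurable_pi_apply e).comp hj
  have hb' := fun e => (measurable_pi_apply e).comp hb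
  refine (Finset.measurable_fun_sum _ fun x _ => measurable_const.mul ?_).neg
  refine Finset.measurable_fun_sum _ fun u _ => (hj' _).mul ?_
  split_ifs
  · exact measurable_const
  · exact hb' u

theorem measurable_bw {T : Type*} [MeasurableSpace T] (β : ℝ) {j : T → Sym2 (Site d) → ℝ}
    {b : T → Site d → ℝ} (hj : Measurable j) (hb : Measurable b) (A : Finset (Site d))
    (s : Site d → ℝ) : Measurable fun x => bw β (j x) A s (b x) :=
  Real.measurable_exp.comp ((measurable_energy hj hb A s).const_mul _)

theorem measurable_wsum {T : Type*} [MeasurableSpace T] (β : ℝ) {j : T → Sym2 (Site d) → ℝ}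
    {b c : T → Site d → ℝ} (hj : Measurable j) (hb : Measurable b) (hc : Measurable c)
    (A : Finset (Site d)) (G : (Site d → ℝ) → (Site d → ℝ) → ℝ) :
    Measurable fun x => wsum β (j x) A (b x) (c x) G := by
  unfold wsum tr₂ tr
  exact Finset.measurable_fun_sum _ fun σ _ => Finset.measurable_fun_sum _ fun τ _ =>
    ((measurable_bw β hj hb A _).mul (measurable_bw β hj hc A _)).const_mul _

theorem measurable_mag {T : Type*} [MeasurableSpace T] (β : ℝ) {j : T → Sym2 (Site d) → ℝ}
    {b : T → Site d → ℝ} (hj : Measurable j) (hb : Measurable b)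
    (A : Finset (Site d)) (x : Site d) : Measurable fun y => mag β (j y) A (b y) x := by
  unfold mag tr
  exact (Finset.measurable_fun_sum _ fun σ _ => (measurable_bw β hj hb A _).const_mul _).div
    (Finset.measurable_fun_sum _ fun σ _ => measurable_bw β hj hb A _)

theorem continuous_bw (β : ℝ) (j : Sym2 (Site d) → ℝ) (A : Finset (Site d)) (s : Site d → ℝ) :
    Continuous fun b : Field d => bw β j A s b.val := by
  unfold bw energy localField Field.val
  refine Real.continuous_exp.comp (continuous_const.mul (Continuous.neg ?_))
  refine continuous_finsetSum _ fun x _ => continuous_const.mul ?_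
  refine continuous_finsetSum _ fun u _ => continuous_const.mul ?_
  split_ifs
  · exact continuous_const
  · exact continuous_subtype_val.comp (continuous_apply u)

theorem continuous_pf (β a : ℝ) (j : Sym2 (Site d) → ℝ) (A : Finset (Site d)) :
    Continuous fun p : Field d × Field d => pf β a j A p.1.val p.2.val := by
  unfold pf wsum tr₂ tr
  exact continuous_finsetSum _ fun σ _ => continuous_finsetSum _ fun τ _ =>
    continuous_const.mul (((continuous_bw β j A _).comp continuous_fst).mul
      ((continuous_bw β j A _).comp continuous_snd))

theorem continuous_mag (β : ℝ) (j : Sym2 (Site d) → ℝ) (A : Finset (Site d)) (x : Site d) :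
    Continuous fun b : Field d => mag β j A b.val x :=
  (continuous_finsetSum _ fun _ _ => continuous_const.mul (continuous_bw β j A _)).div
    (continuous_finsetSum _ fun _ _ => continuous_bw β j A _) fun b => (tr_bw_pos β j A b.val).ne'

end Regularity

/-! ### Maxima over boundary fields and their inequalities -/

/-- The maximum of the two-replica log-partition function over all boundary fields. -/
noncomputable def maxLogPf (β a : ℝ) (A : Finset (Site d)) (j : Sym2 (Site d) → ℝ) : ℝ :=
  ⨆ p : Field d × Field d, Real.log (pf β a j A p.1.val p.2.val)

/-- The maximum over all boundary fields of the logarithm of the exponential moment of the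
overlap. -/
noncomputable def maxLogRatio (β a : ℝ) (A : Finset (Site d)) (j : Sym2 (Site d) → ℝ) : ℝ :=
  ⨆ p : Field d × Field d,
    Real.log (pf β a j A p.1.val p.2.val / pf β 0 j A p.1.val p.2.val)

/-- The maximum over all boundary fields of the expected unnormalized overlap. -/
noncomputable def maxOverlap (β : ℝ) (A : Finset (Site d)) (j : Sym2 (Site d) → ℝ) : ℝ :=
  ⨆ b : Field d, ∑ x ∈ A, mag β j A b.val x ^ 2

theorem measurable_maxLogPf (β a : ℝ) (A : Finset (Site d)) : Measurable (maxLogPf β a A) :=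
  measurable_iSup_of_continuous
    (fun _ => Real.measurable_log.comp
      (measurable_wsum β measurable_id measurable_const measurable_const A _))
    fun j => (continuous_pf β a j A).log fun _ => (pf_pos ..).ne'

theorem measurable_maxLogRatio (β a : ℝ) (A : Finset (Site d)) :
    Measurable (maxLogRatio β a A) :=
  measurable_iSup_of_continuous
    (fun _ => Real.measurable_log.comp
      ((measurable_wsum β measurable_id measurable_const measurable_const A _).div
        (measurable_wsum β measurable_id measurable_const measurable_const A _)))
    fun j => ((continuous_pf β a j A).div (continuous_pf β 0 j A)
      fun _ => (pf_pos ..).ne').log fun _ => (div_pos (pf_pos ..) (pf_pos ..)).ne'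

theorem measurable_maxOverlap (β : ℝ) (A : Finset (Site d)) : Measurable (maxOverlap β A) :=
  measurable_iSup_of_continuous
    (fun _ => Finset.measurable_fun_sum _ fun x _ =>
      (measurable_mag β measurable_id measurable_const A x).pow_const 2)
    fun j => continuous_finsetSum _ fun x _ => (continuous_mag β j A x).pow 2

section Bounds

variable {β a : ℝ} {A B : Finset (Site d)} {j : Sym2 (Site d) → ℝ} {b c : Site d → ℝ}

theorem abs_ciSup_le {ι : Type*} [Nonempty ι] {f : ι → ℝ} {C : ℝ} (h : ∀ i, |f i| ≤ C) :
    |⨆ i, f i| ≤ C := by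
  have hb : BddAbove (Set.range f) := ⟨C, by rintro _ ⟨i, rfl⟩; exact (abs_le.1 (h i)).2⟩
  obtain ⟨i⟩ := ‹Nonempty ι›
  exact abs_le.2 ⟨(abs_le.1 (h i)).1.trans (le_ciSup hb i), ciSup_le fun i => (abs_le.1 (h i)).2⟩

theorem le_ciSup_of_abs_le {ι : Type*} {f : ι → ℝ} {C : ℝ} (h : ∀ i, |f i| ≤ C) (i : ι) :
    f i ≤ ⨆ i, f i :=
  le_ciSup (f := f) ⟨C, by rintro _ ⟨i, rfl⟩; exact (abs_le.1 (h i)).2⟩ i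

theorem log_pf_le (hβ : 0 ≤ β) (hb : IsBC b) (hc : IsBC c) :
    Real.log (pf β a j A b c) ≤ maxLogPf β a A j := by
  obtain ⟨b, rfl⟩ := hb.exists_field
  obtain ⟨c, rfl⟩ := hc.exists_field
  exact le_ciSup_of_abs_le
    (fun p : Field d × Field d => abs_log_pf_le hβ a j A p.1.isBC p.2.isBC) (b, c)

theorem log_pf_div_le (hb : IsBC b) (hc : IsBC c) :
    Real.log (pf β a j A b c / pf β 0 j A b c) ≤ maxLogRatio β a A j := by
  obtain ⟨b, rfl⟩ := hb.exists_field
  obtain ⟨c, rfl⟩ := hc.exists_field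
  exact le_ciSup_of_abs_le
    (fun p : Field d × Field d => abs_log_pf_div_le β a j A p.1.val p.2.val) (b, c)

theorem abs_sum_mag_mul_le (b c : Site d → ℝ) :
    |∑ x ∈ A, mag β j A b x * mag β j A c x| ≤ A.card :=
  abs_ov_le (abs_mag_le β j A b) (abs_mag_le β j A c)

theorem sum_mag_sq_le (hb : IsBC b) : ∑ x ∈ A, mag β j A b x ^ 2 ≤ maxOverlap β A j := by
  obtain ⟨b, rfl⟩ := hb.exists_field
  refine le_ciSup_of_abs_le (f := fun b : Field d => ∑ x ∈ A, mag β j A b.val x ^ 2)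
    (C := A.card) (fun b => ?_) b
  simp only [sq]
  exact abs_sum_mag_mul_le _ _

/-- The inequality |m m'| ≤ (m² + m'²)/2 at each site: letting the replicas have different boundary
fields does not raise the maximal overlap. -/
theorem abs_sum_mag_mul_le_maxOverlap (hb : IsBC b) (hc : IsBC c) :
    |∑ x ∈ A, mag β j A b x * mag β j A c x| ≤ maxOverlap β A j := by
  have h1 := sum_mag_sq_le (β := β) (j := j) (A := A) hb
  have h2 := sum_mag_sq_le (β := β) (j := j) (A := A) hc
  have h3 : |∑ x ∈ A, mag β j A b x * mag β j A c x|
      ≤ ∑ x ∈ A, (mag β j A b x ^ 2 + mag β j A c x ^ 2) / 2 := by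
    refine (Finset.abs_sum_le_sum_abs _ _).trans (Finset.sum_le_sum fun x _ => ?_)
    rw [abs_le]
    constructor <;> nlinarith [sq_nonneg (mag β j A b x + mag β j A c x),
      sq_nonneg (mag β j A b x - mag β j A c x)]
  rw [← Finset.sum_div, Finset.sum_add_distrib] at h3
  linarith

theorem maxOverlap_nonneg : 0 ≤ maxOverlap β A j :=
  (abs_nonneg _).trans (abs_sum_mag_mul_le_maxOverlap isBC_zero isBC_zero)

theorem abs_maxOverlap_le : |maxOverlap β A j| ≤ A.card :=
  abs_ciSup_le fun b => by simp only [sq]; exact abs_sum_mag_mul_le _ _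

theorem abs_maxLogRatio_le : |maxLogRatio β a A j| ≤ |a| * A.card :=
  abs_ciSup_le fun _ => abs_log_pf_div_le ..

theorem abs_maxLogPf_le (hβ : 0 ≤ β) : |maxLogPf β a A j|
    ≤ (|a| + 2 * Real.log 2) * A.card + 2 * β * totalCoupling j A :=
  abs_ciSup_le fun p : Field d × Field d => abs_log_pf_le hβ a j A p.1.isBC p.2.isBC

theorem maxLogPf_le (hβ : 0 ≤ β) (hb : IsBC b) (hc : IsBC c) :
    maxLogPf β a A j ≤ Real.log (pf β a j A b c) + 4 * β * boundaryCoupling j A :=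
  ciSup_le fun p => log_pf_sub_le hβ a j A p.1.isBC p.2.isBC hb hc

theorem maxLogPf_union_le (hβ : 0 ≤ β) (h : Disjoint A B) :
    maxLogPf β a (A ∪ B) j ≤ maxLogPf β a A j + maxLogPf β a B j := by
  refine ciSup_le fun p => ?_
  rw [Real.log_le_iff_le_exp (pf_pos ..), Real.exp_add]
  refine pf_union_le β a j h (fun b c hb hc => ?_) (fun b c hb hc => ?_) p.1.isBC p.2.isBC <;>
  · rw [← Real.log_le_iff_le_exp (pf_pos ..)]
    exact log_pf_le hβ hb hc

theorem maxLogRatio_union_le (h : Disjoint A B) :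
    maxLogRatio β a (A ∪ B) j ≤ maxLogRatio β a A j + maxLogRatio β a B j := by
  refine ciSup_le fun p => ?_
  rw [Real.log_le_iff_le_exp (div_pos (pf_pos ..) (pf_pos ..)), Real.exp_add,
    div_le_iff₀ (pf_pos ..)]
  refine pf_union_le_mul_pf_zero β a j h (fun b c hb hc => ?_) (fun b c hb hc => ?_)
    p.1.isBC p.2.isBC <;>
  · rw [← div_le_iff₀ (pf_pos ..),
      ← Real.log_le_iff_le_exp (div_pos (pf_pos ..) (pf_pos ..))]
    exact log_pf_div_le hb hc

theorem maxLogPf_sub_le (hβ : 0 ≤ β) :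
    maxLogPf β a A j - maxLogPf β 0 A j ≤ maxLogRatio β a A j := by
  rw [sub_le_iff_le_add]
  refine ciSup_le fun p => ?_
  have h1 := log_pf_div_le (β := β) (a := a) (j := j) (A := A) p.1.isBC p.2.isBC
  rw [Real.log_div (pf_pos ..).ne' (pf_pos ..).ne'] at h1
  have h2 := log_pf_le (a := 0) (j := j) (A := A) hβ p.1.isBC p.2.isBC
  linarith

/-- Jensen's inequality, obtained by averaging the tangent-line bound e^y ≥ e^m (1 + y - m) at the
mean m of y = a · overlap. -/
theorem mul_sum_mag_mul_le_log_pf_sub (β a : ℝ) (j : Sym2 (Site d) → ℝ) (A : Finset (Site d))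
    (b c : Site d → ℝ) :
    a * ∑ x ∈ A, mag β j A b x * mag β j A c x
      ≤ Real.log (pf β a j A b c) - Real.log (pf β 0 j A b c) := by
  set m := a * ∑ x ∈ A, mag β j A b x * mag β j A c x with hm
  have key : Real.exp m * pf β 0 j A b c ≤ pf β a j A b c := by
    have h1 : Real.exp m * wsum β j A b c (fun s t => (1 - m) * 1 + a * ov A s t)
        ≤ pf β a j A b c := by
      rw [pf, ← wsum_mul_left]
      refine wsum_mono _ _ _ _ _ fun s t _ _ => ?_
      have := mul_le_mul_of_nonneg_left (Real.add_one_le_exp (a * ov A s t - m))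
        (Real.exp_pos m).le
      rw [← Real.exp_add, add_sub_cancel] at this
      refine le_trans (le_of_eq ?_) this
      ring
    rw [wsum_add, wsum_mul_left, wsum_mul_left, wsum_ov, ← mul_assoc a, ← hm] at h1
    rw [pf_zero]
    refine le_trans (le_of_eq ?_) h1
    ring
  have := Real.log_le_log (mul_pos (Real.exp_pos m) (pf_pos ..)) key
  rw [Real.log_mul (Real.exp_pos _).ne' (pf_pos ..).ne', Real.log_exp] at this
  linarith

/-- Jensen with one field b in both replicas. The boundary term pays for replacing log Z at a = 0
and field b by its maximum. -/
theorem mul_maxOverlap_le (hβ : 0 ≤ β) (ha : 0 ≤ a) :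
    a * maxOverlap β A j
      ≤ maxLogPf β a A j - maxLogPf β 0 A j + 4 * β * boundaryCoupling j A := by
  rw [maxOverlap, Real.mul_iSup_of_nonneg ha]
  refine ciSup_le fun b => ?_
  have h1 := mul_sum_mag_mul_le_log_pf_sub β a j A b.val b.val
  have h2 := log_pf_le (a := a) (j := j) (A := A) hβ b.isBC b.isBC
  have h3 := maxLogPf_le (a := 0) (j := j) (A := A) hβ b.isBC b.isBC
  simp only [sq]
  linarith

/-- Uses log r ≤ r - 1 and e^y ≤ 1 + y + y² for |y| ≤ 1, where y = a · overlap is bounded by a|A|.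
-/
theorem maxLogRatio_le (ha : 0 ≤ a) (haA : a * A.card ≤ 1) :
    maxLogRatio β a A j ≤ a * maxOverlap β A j + (a * A.card) ^ 2 := by
  refine ciSup_le fun p => ?_
  have hpos := pf_pos β 0 j A p.1.val p.2.val
  refine (Real.log_le_sub_one_of_pos (div_pos (pf_pos ..) hpos)).trans ?_
  rw [sub_le_iff_le_add, div_le_iff₀ hpos]
  have h1 : pf β a j A p.1.val p.2.val ≤ wsum β j A p.1.val p.2.val
      fun s t => (1 + (a * A.card) ^ 2) * 1 + a * ov A s t := by
    refine wsum_mono _ _ _ _ _ fun s t hs ht => ?_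
    have h2 : |a * ov A s t| ≤ a * A.card := by
      rw [abs_mul, abs_of_nonneg ha]
      exact mul_le_mul_of_nonneg_left (abs_ov_le hs.isBC ht.isBC) ha
    have h3 := (abs_le.1 (Real.abs_exp_sub_one_sub_id_le (h2.trans haA))).2
    have h4 := pow_le_pow_left₀ (abs_nonneg _) h2 2
    rw [sq_abs] at h4
    linarith
  rw [wsum_add, wsum_mul_left, wsum_mul_left, wsum_ov, ← pf_zero] at h1
  refine h1.trans ?_
  have h5 := mul_le_mul_of_nonneg_left (le_of_abs_le (abs_sum_mag_mul_le_maxOverlap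
    (β := β) (j := j) (A := A) p.1.isBC p.2.isBC)) ha
  nlinarith [mul_le_mul_of_nonneg_right h5 hpos.le]

end Bounds

/-! ### Regions not joined by a bond -/

section Independence

/-- `A` and `B` are disjoint and not joined by any bond. -/
def Separated (A B : Finset (Site d)) : Prop :=
  Disjoint A B ∧ ∀ x ∈ A, ∀ y ∈ B, ¬ (lattice d).Adj x y

theorem wsum_congr_bc {β : ℝ} {j : Sym2 (Site d) → ℝ} {A : Finset (Site d)}
    {b b' c c' : Site d → ℝ} (G : (Site d → ℝ) → (Site d → ℝ) → ℝ)
    (hb : ∀ x ∈ A, ∀ u, u ∉ A → (lattice d).Adj x u → b u = b' u)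
    (hc : ∀ x ∈ A, ∀ u, u ∉ A → (lattice d).Adj x u → c u = c' u) :
    wsum β j A b c G = wsum β j A b' c' G := by
  unfold wsum bw
  simp only [energy_congr (fun _ _ => rfl) (fun _ _ _ _ => rfl) hb,
    energy_congr (fun _ _ => rfl) (fun _ _ _ _ => rfl) hc]

/-- The spins of B never enter the boundary field felt by A, nor the spins of A that felt by B, so
conditioning leaves the fields unchanged. -/
theorem wsum_union_of_separated (β : ℝ) (j : Sym2 (Site d) → ℝ) {A B : Finset (Site d)}
    (h : Separated A B) {F G : (Site d → ℝ) → (Site d → ℝ) → ℝ} (hF : IsLocal A F)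
    (hG : IsLocal B G) (b c : Site d → ℝ) :
    wsum β j (A ∪ B) b c (fun s t => F s t * G s t)
      = wsum β j A b c F * wsum β j B b c G := by
  have hA : ∀ r b : Site d → ℝ, ∀ x ∈ A, ∀ u, u ∉ A → (lattice d).Adj x u →
      B.piecewise r b u = b u :=
    fun r b x hx u _ hxu => Finset.piecewise_eq_of_notMem _ _ _ fun hu => h.2 x hx u hu hxu
  have hB : ∀ r b : Site d → ℝ, ∀ x ∈ B, ∀ u, u ∉ B → (lattice d).Adj x u →
      A.piecewise r b u = b u :=
    fun r b x hx u _ hxu => Finset.piecewise_eq_of_notMem _ _ _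
      fun hu => h.2 u hu x hx hxu.symm
  rw [wsum_union β j h.1 hF hG, ← wsum_mul_left, wsum_congr_bc _ (hB 0 b) (hB 0 c)]
  unfold wsum
  refine tr₂_congr fun s t _ _ => ?_
  have := wsum_congr_bc (β := β) (j := j) F (hA s b) (hA t c)
  unfold wsum at this
  beta_reduce
  rw [this]
  ring

/-- Given the spins outside A ∪ B the two overlaps are independent, and each conditional mean is
bounded by the maximum over boundary fields of its own region. -/
theorem wsum_ov_mul_ov_le (β : ℝ) (j : Sym2 (Site d) → ℝ) {Λ A B : Finset (Site d)}
    (h : Separated A B) (hA : A ⊆ Λ) (hB : B ⊆ Λ) {b c : Site d → ℝ} (hb : IsBC b)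
    (hc : IsBC c) :
    wsum β j Λ b c (fun s t => ov A s t * ov B s t)
      ≤ maxOverlap β A j * maxOverlap β B j * wsum β j Λ b c fun _ _ => 1 := by
  have hAB : A ∪ B ⊆ Λ := Finset.union_subset hA hB
  have hloc : IsLocal (A ∪ B) fun s t => ov A s t * ov B s t :=
    ((isLocal_ov A).mono Finset.subset_union_left).mul
      ((isLocal_ov B).mono Finset.subset_union_right)
  have key := wsum_union_le β j (Finset.disjoint_sdiff (s := A ∪ B) (t := Λ)) hloc
    (isLocal_const (A ∪ B) 1) (isLocal_const (Λ \ (A ∪ B)) 1) (fun _ _ => zero_le_one)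
    (K := maxOverlap β A j * maxOverlap β B j) (fun b c hb hc => ?_) hb hc
  · rw [Finset.union_sdiff_of_subset hAB] at key
    simpa only [mul_one] using key
  · have h1 := wsum_union_of_separated β j h (isLocal_const A 1) (isLocal_const B 1) b c
    simp only [mul_one] at h1
    rw [wsum_union_of_separated β j h (isLocal_ov A) (isLocal_ov B), h1, wsum_ov, wsum_ov]
    have hpos : 0 < (wsum β j A b c fun _ _ => 1) * wsum β j B b c fun _ _ => 1 :=
      mul_pos (wsum_pos _ _ _ _ _ fun _ _ => one_pos) (wsum_pos _ _ _ _ _ fun _ _ => one_pos)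
    have h2 := abs_sum_mag_mul_le_maxOverlap (β := β) (j := j) (A := A) hb hc
    have h3 := abs_sum_mag_mul_le_maxOverlap (β := β) (j := j) (A := B) hb hc
    -- Absolute values are needed because a mean overlap can be negative when the two replicas have
    -- different boundary fields.
    have h4 := mul_le_mul h2 h3 (abs_nonneg _) maxOverlap_nonneg
    rw [← abs_mul] at h4
    have h5 := mul_le_mul_of_nonneg_right (le_of_abs_le h4) hpos.le
    refine le_trans (le_of_eq ?_) h5
    ring

theorem maxOverlap_congr (β : ℝ) {A : Finset (Site d)} {j j' : Sym2 (Site d) → ℝ}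
    (h : ∀ x ∈ A, ∀ u, (lattice d).Adj x u → j s(x, u) = j' s(x, u)) :
    maxOverlap β A j = maxOverlap β A j' := by
  unfold maxOverlap mag bw
  simp only [energy_congr (fun _ _ => rfl) h fun _ _ _ _ _ => rfl]

end Independence

/-! ### Translation of regions and couplings -/

section Translation

/-- The translate of a finite set of sites. -/
def translate (v : Site d) (A : Finset (Site d)) : Finset (Site d) :=
  A.map (addRightEmbedding v)

@[simp]
theorem mem_translate {v x : Site d} {A : Finset (Site d)} : x ∈ translate v A ↔ x - v ∈ A := by
  simp only [translate, Finset.mem_map, addRightEmbedding_apply]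
  exact ⟨by rintro ⟨a, ha, rfl⟩; simpa, fun h => ⟨_, h, sub_add_cancel x v⟩⟩

@[simp]
theorem card_translate (v : Site d) (A : Finset (Site d)) : (translate v A).card = A.card :=
  Finset.card_map _

/-- The translated couplings. -/
def shift (v : Site d) (j : Sym2 (Site d) → ℝ) (e : Sym2 (Site d)) : ℝ := j (e.map (· + v))

@[simp]
theorem adj_add_right {v x u : Site d} :
    (lattice d).Adj (x + v) (u + v) ↔ (lattice d).Adj x u := by
  simp [lattice]

theorem nbrs_add (v x : Site d) : nbrs (x + v) = translate v (nbrs x) := by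
  ext u
  rw [mem_translate, mem_nbrs, mem_nbrs, ← adj_add_right (v := v) (u := u - v), sub_add_cancel]

theorem energy_translate (j : Sym2 (Site d) → ℝ) (v : Site d) (A : Finset (Site d))
    (s b : Site d → ℝ) :
    energy j (translate v A) s b
      = energy (shift v j) A (fun x => s (x + v)) fun x => b (x + v) := by
  unfold energy localField
  have hm : ∀ u, u + v ∈ translate v A ↔ u ∈ A := fun u => by simp
  have hsum : ∀ (B : Finset (Site d)) (f : Site d → ℝ),
      ∑ x ∈ translate v B, f x = ∑ x ∈ B, f (x + v) := fun B f => Finset.sum_map _ _ _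
  simp only [hsum, nbrs_add, hm, shift, Sym2.map_mk]

/-- The sites of `A` correspond to those of its translate. -/
def translateEquiv (v : Site d) (A : Finset (Site d)) : A ≃ translate v A where
  toFun x := ⟨x + v, by simp⟩
  invFun x := ⟨x - v, mem_translate.1 x.2⟩
  left_inv x := by simp
  right_inv x := by simp

theorem tr_translate (v : Site d) (A : Finset (Site d)) (f : (Site d → ℝ) → ℝ) :
    tr (translate v A) f = tr A fun s => f fun x => s (x - v) := by
  unfold tr
  refine (Equiv.sum_comp (Equiv.arrowCongr (translateEquiv v A) (Equiv.refl ℤˣ))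
    fun σ : Config (translate v A) => f (ext σ)).symm.trans ?_
  refine Finset.sum_congr rfl fun σ _ => ?_
  congr 1
  funext x
  by_cases h : x - v ∈ A
  · have h' : x ∈ translate v A := mem_translate.2 h
    simp only [ext, h, h', dite_true]
    rfl
  · have h' : x ∉ translate v A := fun h' => h (mem_translate.1 h')
    simp [ext, h, h']

theorem bw_translate (β : ℝ) (j : Sym2 (Site d) → ℝ) (v : Site d) (A : Finset (Site d))
    (s b : Site d → ℝ) :
    bw β j (translate v A) (fun x => s (x - v)) b = bw β (shift v j) A s fun x => b (x + v) := by
  simp only [bw, energy_translate, add_sub_cancel_right]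

theorem pf_translate (β a : ℝ) (j : Sym2 (Site d) → ℝ) (v : Site d) (A : Finset (Site d))
    (b c : Site d → ℝ) :
    pf β a j (translate v A) b c
      = pf β a (shift v j) A (fun x => b (x + v)) fun x => c (x + v) := by
  have : ∀ s t : Site d → ℝ,
      ov (translate v A) (fun x => s (x - v)) (fun x => t (x - v)) = ov A s t := fun s t => by
    simp [ov, translate]
  simp only [pf, wsum, tr₂, tr_translate, bw_translate, this]

theorem mag_translate (β : ℝ) (j : Sym2 (Site d) → ℝ) (v : Site d) (A : Finset (Site d))
    (b : Site d → ℝ) (x : Site d) :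
    mag β j (translate v A) b (x + v) = mag β (shift v j) A (fun x => b (x + v)) x := by
  simp only [mag, tr_translate, bw_translate, add_sub_cancel_right]

theorem surjective_field_shift (v : Site d) :
    Function.Surjective fun (b : Field d) (x : Site d) => b (x + v) :=
  fun b => ⟨fun x => b (x - v), by simp⟩

/-- The set of all boundary fields is translation invariant, so moving the region only shifts the
couplings. -/
theorem maxOverlap_translate (β : ℝ) (j : Sym2 (Site d) → ℝ) (v : Site d)
    (A : Finset (Site d)) : maxOverlap β (translate v A) j = maxOverlap β A (shift v j) := by
  refine (surjective_field_shift v).iSup_congr _ fun b => ?_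
  rw [translate, Finset.sum_map]
  simp only [addRightEmbedding_apply, ← translate.eq_1, mag_translate]
  rfl

theorem maxLogPf_translate (β a : ℝ) (j : Sym2 (Site d) → ℝ) (v : Site d)
    (A : Finset (Site d)) : maxLogPf β a (translate v A) j = maxLogPf β a A (shift v j) := by
  refine ((surjective_field_shift v).prodMap (surjective_field_shift v)).iSup_congr _
    fun b => ?_
  rw [pf_translate]
  rfl

theorem maxLogRatio_translate (β a : ℝ) (j : Sym2 (Site d) → ℝ) (v : Site d)
    (A : Finset (Site d)) :
    maxLogRatio β a (translate v A) j = maxLogRatio β a A (shift v j) := by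
  refine ((surjective_field_shift v).prodMap (surjective_field_shift v)).iSup_congr _
    fun b => ?_
  rw [pf_translate, pf_translate]
  rfl

end Translation

/-! ### Comparison with the definitions of the model -/

theorem mem_bonds {Λ : Finset (Site d)} {x y : Λ} :
    s(x, y) ∈ bonds Λ ↔ (lattice d).Adj x y := by
  simp [bonds]

theorem two_mul_sum_bonds {Λ : Finset (Site d)} (f : Sym2 Λ → ℝ) :
    2 * ∑ e ∈ bonds Λ, f e
      = ∑ p : Λ × Λ with (lattice d).Adj p.1 p.2, f s(p.1, p.2) := by
  rw [← Finset.sum_fiberwise_of_maps_to (t := bonds Λ) (g := fun p : Λ × Λ => s(p.1, p.2))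
    (fun p hp => mem_bonds.2 (Finset.mem_filter.1 hp).2), Finset.mul_sum]
  refine Finset.sum_congr rfl fun e he => ?_
  induction e using Sym2.inductionOn with
  | hf x y =>
    rw [mem_bonds] at he
    have hne : (x, y) ≠ (y, x) := fun h => by
      have h' : x = y := (Prod.mk.inj h).1
      exact he.ne (by rw [h'])
    have : ((Finset.univ.filter fun p : Λ × Λ => (lattice d).Adj p.1 p.2).filter
        fun p => s(p.1, p.2) = s(x, y)) = {(x, y), (y, x)} := by
      ext ⟨a, b⟩
      simp only [Finset.mem_filter, Finset.mem_univ, true_and, Finset.mem_insert,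
        Finset.mem_singleton, Sym2.eq_iff, Prod.mk.injEq]
      constructor
      · exact fun h => h.2
      · rintro (⟨rfl, rfl⟩ | ⟨rfl, rfl⟩)
        · exact ⟨he, Or.inl ⟨rfl, rfl⟩⟩
        · exact ⟨he.symm, Or.inr ⟨rfl, rfl⟩⟩
    rw [this, Finset.sum_pair hne, Sym2.eq_swap (a := y) (b := x)]
    ring

/-- A boundary configuration, extended by zero. -/
noncomputable def extBC {Λ : Finset (Site d)} (b : BoundaryConfig Λ) (u : Site d) : ℝ :=
  if h : u ∈ boundary Λ then (b ⟨u, h⟩ : ℝ) else 0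

theorem isBC_extBC {Λ : Finset (Site d)} (b : BoundaryConfig Λ) : IsBC (extBC b) := fun u => by
  unfold extBC
  split_ifs with h
  · exact abs_le.2 (b ⟨u, h⟩).2
  · simp

@[simp]
theorem ext_coe {Λ : Finset (Site d)} (σ : Config Λ) (x : Λ) : ext σ x = spin σ x := by
  simp [ext]

@[simp]
theorem extBC_coe {Λ : Finset (Site d)} (b : BoundaryConfig Λ) (u : boundary Λ) :
    extBC b u = b u := by
  simp [extBC]

/-- Each interior bond is met from both endpoints, which the halves in `localField` compensate; each
boundary bond is met once. -/
theorem hamiltonian_eq {Λ : Finset (Site d)} (j : Sym2 (Site d) → ℝ) (b : BoundaryConfig Λ)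
    (σ : Config Λ) : hamiltonian j b σ = energy j Λ (ext σ) (extBC b) := by
  have h1 : ∑ e ∈ bonds Λ, j (e.map Subtype.val) * (e.map (spin σ)).mul
      = ∑ x ∈ Λ, ∑ u ∈ Λ, if (lattice d).Adj x u then j s(x, u) * ext σ x * (ext σ u / 2)
          else 0 := by
    have := two_mul_sum_bonds fun e : Sym2 Λ => j (e.map Subtype.val) * (e.map (spin σ)).mul
    rw [Finset.sum_filter, Fintype.sum_prod_type] at this
    rw [← Finset.sum_coe_sort Λ]
    simp_rw [← Finset.sum_coe_sort Λ (fun u => if (lattice d).Adj _ u then _ else _)]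
    rw [← mul_right_inj' (two_ne_zero (α := ℝ)), this]
    simp only [Finset.mul_sum, Sym2.map_mk, Sym2.mul_mk, ext_coe]
    refine Finset.sum_congr rfl fun x _ => Finset.sum_congr rfl fun y _ => ?_
    split_ifs <;> ring
  have h2 : ∑ p ∈ boundaryBonds Λ, j s((p.1 : Site d), (p.2 : Site d)) * spin σ p.1 * (b p.2 : ℝ)
      = ∑ x ∈ Λ, ∑ u ∈ boundary Λ,
          if (lattice d).Adj x u then j s(x, u) * ext σ x * extBC b u else 0 := by
    rw [boundaryBonds, Finset.sum_filter, Fintype.sum_prod_type, ← Finset.sum_coe_sort Λ]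
    simp_rw [← Finset.sum_coe_sort (boundary Λ)]
    simp only [ext_coe, extBC_coe]
  rw [hamiltonian, h1, h2, energy, ← neg_add', neg_inj, ← Finset.sum_add_distrib]
  refine Finset.sum_congr rfl fun x hx => ?_
  rw [← sum_nbrs_ite_mem (fun u => j s(x, u) * ext σ x * (ext σ u / 2)),
    ← sum_nbrs_ite_mem (fun u => j s(x, u) * ext σ x * extBC b u), ← Finset.sum_add_distrib,
    localField, Finset.mul_sum]
  refine Finset.sum_congr rfl fun u hu => ?_
  rw [mem_nbrs] at hu
  by_cases huΛ : u ∈ Λ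
  · have : u ∉ boundary Λ := fun h => (mem_boundary.1 h).1 huΛ
    simp only [huΛ, this, if_true, if_false]
    ring
  · have : u ∈ boundary Λ := mem_boundary.2 ⟨huΛ, x, hx, hu⟩
    simp only [huΛ, this, if_true, if_false]
    ring

theorem sum_spin_mul_spin {Λ : Finset (Site d)} (σ τ : Config Λ) :
    ∑ x, spin σ x * spin τ x = ov Λ (ext σ) (ext τ) := by
  rw [ov, ← Finset.sum_coe_sort Λ]
  simp only [ext_coe]

theorem exp_hamiltonian₂ {Λ : Finset (Site d)} (β lam : ℝ) (j : Sym2 (Site d) → ℝ)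
    (b : BoundaryConfig Λ) (σ τ : Config Λ) :
    Real.exp (-β * hamiltonian₂ lam j b σ τ)
      = Real.exp (β * lam * ov Λ (ext σ) (ext τ))
        * (bw β j Λ (ext σ) (extBC b) * bw β j Λ (ext τ) (extBC b)) := by
  rw [bw, bw, ← Real.exp_add, ← Real.exp_add, hamiltonian₂, hamiltonian_eq, hamiltonian_eq,
    sum_spin_mul_spin]
  congr 1
  ring

theorem partition₂_eq {Λ : Finset (Site d)} (β lam : ℝ) (j : Sym2 (Site d) → ℝ)
    (b : BoundaryConfig Λ) :
    partition₂ β lam j b = pf β (β * lam) j Λ (extBC b) (extBC b) :=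
  Finset.sum_congr rfl fun σ _ => Finset.sum_congr rfl fun τ _ => exp_hamiltonian₂ β lam j b σ τ

theorem gibbs₂_eq {Λ : Finset (Site d)} (β : ℝ) (j : Sym2 (Site d) → ℝ)
    (b : BoundaryConfig Λ) {F : Config Λ → Config Λ → ℝ}
    {G : (Site d → ℝ) → (Site d → ℝ) → ℝ} (h : ∀ σ τ, F σ τ = G (ext σ) (ext τ)) :
    gibbs₂ β 0 j b F
      = wsum β j Λ (extBC b) (extBC b) G / wsum β j Λ (extBC b) (extBC b) fun _ _ => 1 := by
  rw [gibbs₂, partition₂_eq, mul_zero, pf_zero]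
  congr 1
  refine Finset.sum_congr rfl fun σ _ => Finset.sum_congr rfl fun τ _ => ?_
  rw [h, exp_hamiltonian₂, mul_zero, zero_mul, Real.exp_zero, one_mul]

theorem overlap_eq {Λ : Finset (Site d)} (σ τ : Config Λ) :
    overlap σ τ = (Λ.card : ℝ)⁻¹ * ov Λ (ext σ) (ext τ) := by
  rw [overlap, sum_spin_mul_spin, div_eq_inv_mul]

theorem gibbs₂_overlap {Λ : Finset (Site d)} (β : ℝ) (j : Sym2 (Site d) → ℝ)
    (b : BoundaryConfig Λ) :
    gibbs₂ β 0 j b overlap = (Λ.card : ℝ)⁻¹ * ∑ x ∈ Λ, mag β j Λ (extBC b) x ^ 2 := by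
  rw [gibbs₂_eq β j b (G := fun s t => (Λ.card : ℝ)⁻¹ * ov Λ s t) overlap_eq,
    wsum_mul_left, wsum_ov, mul_div_assoc,
    mul_div_cancel_right₀ _ (wsum_pos _ _ _ _ _ fun _ _ => one_pos).ne']
  simp only [sq]

/-- Every boundary configuration is the restriction of a field on the lattice, and only that
restriction affects the energy. -/
theorem iSup_gibbs₂_overlap {Λ : Finset (Site d)} (β : ℝ) (j : Sym2 (Site d) → ℝ) :
    ⨆ b : BoundaryConfig Λ, gibbs₂ β 0 j b overlap
      = (Λ.card : ℝ)⁻¹ * maxOverlap β Λ j := by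
  rw [maxOverlap, Real.mul_iSup_of_nonneg (by positivity)]
  have hsurj : Function.Surjective
      fun (b : Field d) => (fun u => b u : BoundaryConfig Λ) := fun b => by
    classical
    refine ⟨fun u => if h : u ∈ boundary Λ then b ⟨u, h⟩ else ⟨0, by norm_num⟩, ?_⟩
    funext u
    simp
  refine (hsurj.iSup_congr _ fun b => ?_).symm
  rw [gibbs₂_overlap]
  congr 1
  refine Finset.sum_congr rfl fun x _ => ?_
  unfold mag bw
  have : ∀ s, energy j Λ s (extBC fun u : boundary Λ => b u) = energy j Λ s b.val := fun s =>
    energy_congr (fun _ _ => rfl) (fun _ _ _ _ => rfl) fun x hx u hu hxu => by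
      simp [extBC, mem_boundary.2 ⟨hu, x, hx, hxu⟩, Field.val]
  simp only [this]

theorem gibbs₂_overlap_sq {Λ : Finset (Site d)} (β : ℝ) (j : Sym2 (Site d) → ℝ)
    (b : BoundaryConfig Λ) :
    gibbs₂ β 0 j b (fun σ τ => overlap σ τ ^ 2)
      = ((Λ.card : ℝ) ^ 2)⁻¹ * (wsum β j Λ (extBC b) (extBC b) (fun s t => ov Λ s t ^ 2)
        / wsum β j Λ (extBC b) (extBC b) fun _ _ => 1) := by
  rw [gibbs₂_eq β j b (G := fun s t => ((Λ.card : ℝ) ^ 2)⁻¹ * ov Λ s t ^ 2)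
    fun σ τ => by rw [overlap_eq, mul_pow, inv_pow], wsum_mul_left, mul_div_assoc]

theorem measurable_extBC {Λ : Finset (Site d)} :
    Measurable (extBC : BoundaryConfig Λ → Site d → ℝ) := by
  refine measurable_pi_lambda _ fun u => ?_
  unfold extBC
  split_ifs with h
  · exact measurable_subtype_coe.comp (measurable_pi_apply _)
  · exact measurable_const

section Congr

variable {Λ : Finset (Site d)} {j j' : Sym2 (Site d) → ℝ}

/-- This permits replacing the couplings by zero off the lattice bonds, where nothing is assumed
about them. -/
theorem hamiltonian_congr (h : ∀ e ∈ (lattice d).edgeSet, j e = j' e) :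
    (hamiltonian j : BoundaryConfig Λ → Config Λ → ℝ) = hamiltonian j' := by
  funext b σ
  rw [hamiltonian_eq, hamiltonian_eq]
  exact energy_congr (fun _ _ => rfl) (fun _ _ _ hxu => h _ hxu) fun _ _ _ _ _ => rfl

theorem partition₂_congr (h : ∀ e ∈ (lattice d).edgeSet, j e = j' e) (β lam : ℝ)
    (b : BoundaryConfig Λ) : partition₂ β lam j b = partition₂ β lam j' b := by
  simp only [partition₂, hamiltonian₂, hamiltonian_congr h]

theorem gibbs₂_congr (h : ∀ e ∈ (lattice d).edgeSet, j e = j' e) (β lam : ℝ)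
    (b : BoundaryConfig Λ) (F : Config Λ → Config Λ → ℝ) :
    gibbs₂ β lam j b F = gibbs₂ β lam j' b F := by
  simp only [gibbs₂, partition₂, hamiltonian₂, hamiltonian_congr h]

end Congr

/-! ### Tiling a box -/

/-- The lower corner of the tile with index `n`. -/
def corner (k : ℕ) (n : Fin d → ℕ) : Site d := fun i => (k : ℤ) * n i

/-- The tile of side `k` with index `n`. -/
noncomputable def tile (k : ℕ) (n : Fin d → ℕ) : Finset (Site d) :=
  translate (corner k n) (box d k)

/-- The indices of the tiles of a box of side `k * M`. -/
def tileIndices (d M : ℕ) : Finset (Fin d → ℕ) := Fintype.piFinset fun _ => Finset.range M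

theorem card_tileIndices (d M : ℕ) : (tileIndices d M).card = M ^ d := by
  simp [tileIndices]

theorem card_tile (k : ℕ) (n : Fin d → ℕ) : (tile k n).card = k ^ d := by
  rw [tile, card_translate, card_box]

theorem mem_tile {k : ℕ} {n : Fin d → ℕ} {x : Site d} :
    x ∈ tile k n ↔ ∀ i, (k : ℤ) * n i + 1 ≤ x i ∧ x i ≤ k * (n i + 1) := by
  simp only [tile, mem_translate, box, Fintype.mem_piFinset, Finset.mem_Icc, corner, Pi.sub_apply]
  refine forall_congr' fun i => ?_
  rw [mul_add, mul_one]
  constructor <;> rintro ⟨h1, h2⟩ <;> constructor <;> linarith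

theorem tile_subset_box {k M L : ℕ} (h : k * M ≤ L) {n : Fin d → ℕ} (hn : n ∈ tileIndices d M) :
    tile k n ⊆ box d L := fun x hx => by
  rw [mem_tile] at hx
  simp only [box, Fintype.mem_piFinset, Finset.mem_Icc]
  simp only [tileIndices, Fintype.mem_piFinset, Finset.mem_range] at hn
  intro i
  have h1 : (0 : ℤ) ≤ k * n i := by positivity
  have h2 : k * (n i + 1) ≤ L := (Nat.mul_le_mul_left k (hn i)).trans h
  have h3 : (k : ℤ) * (n i + 1) ≤ L := by exact_mod_cast h2
  exact ⟨by linarith [(hx i).1], (hx i).2.trans h3⟩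

/-- Here `r` counts tiles lying strictly between the two in direction i: r = 0 yields disjointness,
r = 1 a gap too wide for a bond. -/
theorem tile_lt {k : ℕ} {n m : Fin d → ℕ} {i : Fin d} {r : ℕ} (h : n i + 1 + r ≤ m i)
    {x y : Site d} (hx : x ∈ tile k n) (hy : y ∈ tile k m) : x i + k * r < y i := by
  have h1 := (mem_tile.1 hx i).2
  have h2 := (mem_tile.1 hy i).1
  have h3 : k * (n i + 1 + r) ≤ k * m i := Nat.mul_le_mul_left k h
  have h4 : (k : ℤ) * (n i + 1 + r) ≤ k * m i := by exact_mod_cast h3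
  linarith

theorem disjoint_tile {k : ℕ} {n m : Fin d → ℕ} (h : n ≠ m) :
    Disjoint (tile k n) (tile k m) := by
  obtain ⟨i, hi⟩ := Function.ne_iff.1 h
  rw [Finset.disjoint_left]
  intro x hx hy
  rcases Nat.lt_or_gt_of_ne hi with hi | hi
  · have := tile_lt (r := 0) hi hx hy
    simp at this
  · have := tile_lt (r := 0) hi hy hx
    simp at this

theorem separated_tile {k : ℕ} (hk : 1 ≤ k) {n m : Fin d → ℕ}
    (h : ∃ i, n i + 2 ≤ m i ∨ m i + 2 ≤ n i) : Separated (tile k n) (tile k m) := by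
  refine ⟨disjoint_tile ?_, fun x hx y hy hxy => ?_⟩
  · rintro rfl
    obtain ⟨i, hi⟩ := h
    omega
  · obtain ⟨i, hi⟩ := h
    have hle := abs_le.1 (abs_sub_le_of_adj hxy i)
    have hk' : (1 : ℤ) ≤ k := by exact_mod_cast hk
    rcases hi with hi | hi
    · have := tile_lt (r := 1) hi hx hy
      push_cast at this
      linarith
    · have := tile_lt (r := 1) hi hy hx
      push_cast at this
      linarith

/-- The union of the tiles. -/
noncomputable def tiles (d k M : ℕ) : Finset (Site d) := (tileIndices d M).biUnion (tile k)

theorem tiles_subset_box {k M L : ℕ} (h : k * M ≤ L) : tiles d k M ⊆ box d L :=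
  Finset.biUnion_subset.2 fun _ hn => tile_subset_box h hn

theorem sum_tiles (k M : ℕ) (f : Site d → ℝ) :
    ∑ x ∈ tiles d k M, f x = ∑ n ∈ tileIndices d M, ∑ x ∈ tile k n, f x :=
  Finset.sum_biUnion fun _ _ _ _ h => disjoint_tile h

theorem card_tiles (d k M : ℕ) : (tiles d k M).card = (k * M) ^ d := by
  rw [tiles, Finset.card_biUnion fun _ _ _ _ h => disjoint_tile h,
    Finset.sum_congr rfl fun n _ => card_tile k n, Finset.sum_const, card_tileIndices,
    smul_eq_mul, mul_pow, mul_comm]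

theorem card_box_sdiff_tiles {k M L : ℕ} (h : k * M ≤ L) :
    ((box d L \ tiles d k M).card : ℝ) = (L : ℝ) ^ d - ((k * M : ℕ) : ℝ) ^ d := by
  rw [Finset.card_sdiff_of_subset (tiles_subset_box h), card_box, card_tiles,
    Nat.cast_sub (Nat.pow_le_pow_left h d), Nat.cast_pow, Nat.cast_pow]

/-- The number of neighbouring tiles is at most `3 ^ d`. -/
theorem card_near_le (M : ℕ) (n : Fin d → ℕ) :
    ((tileIndices d M).filter fun m => ¬ ∃ i, n i + 2 ≤ m i ∨ m i + 2 ≤ n i).card ≤ 3 ^ d := by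
  -- Truncated subtraction at n i = 0 only shortens the interval, so it still has at most three
  -- elements.
  refine (Finset.card_le_card (t := Fintype.piFinset fun i => Finset.Icc (n i - 1) (n i + 1))
    fun m hm => ?_).trans ?_
  · simp only [Finset.mem_filter, not_exists, not_or, not_le] at hm
    simp only [Fintype.mem_piFinset, Finset.mem_Icc]
    intro i
    have := hm.2 i
    omega
  · rw [Fintype.card_piFinset]
    refine (Finset.prod_le_pow_card _ _ 3 fun i _ => ?_).trans (by simp)
    rw [Nat.card_Icc]
    omega

/-! ### Subadditive limits and right derivatives -/

theorem subadditive_biUnion_le {ι : Type*} {φ : Finset (Site d) → ℝ}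
    (hsub : ∀ A B, Disjoint A B → φ (A ∪ B) ≤ φ A + φ B) (h0 : φ ∅ ≤ 0)
    {t : ι → Finset (Site d)} (ht : ∀ i j, i ≠ j → Disjoint (t i) (t j)) (S : Finset ι) :
    φ (S.biUnion t) ≤ ∑ i ∈ S, φ (t i) := by
  classical
  induction S using Finset.induction_on with
  | empty => simpa using h0
  | insert i S hi ih =>
    rw [Finset.biUnion_insert, Finset.sum_insert hi]
    refine (hsub _ _ ?_).trans (add_le_add le_rfl ih)
    rw [Finset.disjoint_biUnion_right]
    exact fun j hj => ht i j fun h => hi (h ▸ hj)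

/-- The box splits into M^d translates of the small box and leftover sites, each costing at most C.
-/
theorem subadditive_box_le {φ : Finset (Site d) → ℝ}
    (hsub : ∀ A B, Disjoint A B → φ (A ∪ B) ≤ φ A + φ B)
    (htr : ∀ v A, φ (translate v A) = φ A) {C : ℝ} (hC : ∀ A, φ A ≤ C * A.card)
    {k M L : ℕ} (h : k * M ≤ L) :
    φ (box d L) ≤ (M : ℝ) ^ d * φ (box d k) + C * ((L : ℝ) ^ d - ((k * M : ℕ) : ℝ) ^ d) := by
  have h1 : φ (tiles d k M) ≤ (M : ℝ) ^ d * φ (box d k) := by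
    refine (subadditive_biUnion_le hsub (by simpa using hC ∅) (fun _ _ h => disjoint_tile h)
      _).trans (le_of_eq ?_)
    have htile : ∀ n : Fin d → ℕ, φ (tile k n) = φ (box d k) := fun n => htr _ _
    rw [Finset.sum_congr rfl fun n _ => htile n, Finset.sum_const,
      card_tileIndices, nsmul_eq_mul, Nat.cast_pow]
  have h2 := hsub _ _ (Finset.disjoint_sdiff (s := tiles d k M) (t := box d L))
  rw [Finset.union_sdiff_of_subset (tiles_subset_box h)] at h2
  have h3 := hC (box d L \ tiles d k M)
  rw [card_box_sdiff_tiles h] at h3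
  linarith

theorem tendsto_mul_div_div {k : ℕ} (hk : 1 ≤ k) :
    Tendsto (fun L : ℕ => ((k * (L / k) : ℕ) : ℝ) / L) atTop (𝓝 1) := by
  have h1 : Tendsto (fun L : ℕ => 1 - (k : ℝ) / L) atTop (𝓝 1) := by
    simpa using tendsto_const_nhds.sub (tendsto_const_div_atTop_nhds_zero_nat (k : ℝ))
  refine tendsto_of_tendsto_of_tendsto_of_le_of_le' h1 tendsto_const_nhds ?_ ?_
  · filter_upwards [eventually_ge_atTop 1] with L hL
    have hL' : (0 : ℝ) < L := by exact_mod_cast hL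
    rw [one_sub_div hL'.ne']
    refine div_le_div_of_nonneg_right ?_ hL'.le
    have h2 : L ≤ k * (L / k) + k := by
      have := Nat.div_add_mod L k
      have := Nat.mod_lt L hk
      omega
    have h3 : (L : ℝ) ≤ (k * (L / k) : ℕ) + k := by exact_mod_cast h2
    linarith
  · filter_upwards with L
    exact div_le_one_of_le₀ (by exact_mod_cast Nat.mul_div_le L k) (Nat.cast_nonneg L)

theorem subadditive_eventually_le {φ : Finset (Site d) → ℝ}
    (hsub : ∀ A B, Disjoint A B → φ (A ∪ B) ≤ φ A + φ B)
    (htr : ∀ v A, φ (translate v A) = φ A) {C : ℝ} (hC : ∀ A, φ A ≤ C * A.card)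
    (k : ℕ) (hk : 1 ≤ k) (ε : ℝ) (hε : 0 < ε) :
    ∀ᶠ L : ℕ in atTop, φ (box d L) / (L : ℝ) ^ d ≤ φ (box d k) / (k : ℝ) ^ d + ε := by
  have hlim : Tendsto (fun L : ℕ => (((k * (L / k) : ℕ) : ℝ) / L) ^ d * (φ (box d k) / (k : ℝ) ^ d)
      + C * (1 - (((k * (L / k) : ℕ) : ℝ) / L) ^ d)) atTop (𝓝 (φ (box d k) / (k : ℝ) ^ d)) := by
    have := (tendsto_mul_div_div hk).pow d
    simpa using (this.mul_const (φ (box d k) / (k : ℝ) ^ d)).add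
      (((tendsto_const_nhds (x := (1 : ℝ))).sub this).const_mul C)
  filter_upwards [hlim.eventually_le_const (lt_add_of_pos_right _ hε), eventually_ge_atTop 1]
    with L hL hL1
  refine le_trans ?_ hL
  have hk' : (0 : ℝ) < k := by exact_mod_cast hk
  have hL' : (0 : ℝ) < (L : ℝ) ^ d := by
    have : (0 : ℝ) < L := by exact_mod_cast hL1
    positivity
  rw [div_le_iff₀ hL']
  refine (subadditive_box_le hsub htr hC (Nat.mul_div_le L k)).trans (le_of_eq ?_)
  push_cast
  rw [div_pow, mul_pow]
  field_simp

/-- The limit is the infimum over positive indices; index 0 is excluded, hence the shift by one. -/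
theorem exists_tendsto_of_eventually_le {a : ℕ → ℝ}
    (h : ∀ k, 1 ≤ k → ∀ ε, 0 < ε → ∀ᶠ L in atTop, a L ≤ a k + ε) {B : ℝ}
    (hB : ∀ L, 1 ≤ L → B ≤ a L) :
    ∃ l, Tendsto a atTop (𝓝 l) ∧ ∀ k, 1 ≤ k → l ≤ a k := by
  have hbdd : BddBelow (Set.range fun k => a (k + 1)) := ⟨B, by
    rintro _ ⟨k, rfl⟩
    exact hB _ (Nat.le_add_left 1 k)⟩
  have hle : ∀ k, 1 ≤ k → ⨅ k, a (k + 1) ≤ a k := fun k hk => by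
    have := ciInf_le hbdd (k - 1)
    rwa [Nat.sub_add_cancel hk] at this
  refine ⟨⨅ k, a (k + 1), ?_, hle⟩
  rw [tendsto_order]
  constructor
  · intro r hr
    filter_upwards [eventually_ge_atTop 1] with L hL using hr.trans_le (hle L hL)
  · intro r hr
    obtain ⟨k, hk⟩ := exists_lt_of_ciInf_lt hr
    filter_upwards [h (k + 1) (Nat.le_add_left 1 k) ((r - a (k + 1)) / 2) (by linarith)] with L hL
    linarith

/-- The number of bonds between the box and its complement is negligible. -/
theorem tendsto_card_boundary_bonds :
    Tendsto (fun L : ℕ => ((∑ x ∈ box d L, ((nbrs x).filter (· ∉ box d L)).card : ℕ) : ℝ)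
      / (L : ℝ) ^ d) atTop (𝓝 0) := by
  have hlim : Tendsto (fun L : ℕ => (3 : ℝ) ^ d * (1 - (1 - (2 : ℝ) / L) ^ d)) atTop (𝓝 0) := by
    have h1 : Tendsto (fun L : ℕ => 1 - (2 : ℝ) / L) atTop (𝓝 1) := by
      simpa using tendsto_const_nhds.sub (tendsto_const_div_atTop_nhds_zero_nat (2 : ℝ))
    simpa using ((tendsto_const_nhds (x := (1 : ℝ))).sub (h1.pow d)).const_mul ((3 : ℝ) ^ d)
  refine squeeze_zero' (Eventually.of_forall fun L => by positivity) ?_ hlim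
  filter_upwards [eventually_ge_atTop 2] with L hL
  have hL0 : (0 : ℝ) < L := by
    have : 0 < L := by omega
    exact_mod_cast this
  -- A site off the outermost layer has all its neighbours in the box, so only the outermost layer
  -- contributes.
  set inner : Finset (Site d) := Fintype.piFinset fun _ => Finset.Icc 2 ((L : ℤ) - 1) with hinner
  have hsub : inner ⊆ box d L := Fintype.piFinset_subset _ _ fun _ =>
    Finset.Icc_subset_Icc (by norm_num) (by linarith)
  have hcard : inner.card = (L - 2) ^ d := by
    have : ((L : ℤ) - 2).toNat = L - 2 := by omega
    simp [hinner, this]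
  have hzero : ∀ x ∈ inner, ((nbrs x).filter (· ∉ box d L)).card = 0 := by
    intro x hx
    rw [Finset.card_eq_zero, Finset.filter_eq_empty_iff]
    intro u hu
    rw [not_not]
    simp only [hinner, box, Fintype.mem_piFinset, Finset.mem_Icc] at hx ⊢
    intro i
    have := abs_le.1 (abs_sub_le_of_adj (mem_nbrs.1 hu) i)
    have := hx i
    constructor <;> linarith
  have hle : ∑ x ∈ box d L, ((nbrs x).filter (· ∉ box d L)).card
      ≤ (L ^ d - (L - 2) ^ d) * 3 ^ d := by
    rw [← Finset.sum_sdiff hsub, Finset.sum_eq_zero hzero, add_zero, ← hcard,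
      ← card_box d L, ← Finset.card_sdiff_of_subset hsub, ← smul_eq_mul]
    exact Finset.sum_le_card_nsmul _ _ _ fun x _ =>
      (Finset.card_filter_le _ _).trans (card_nbrs_le x)
  rw [div_le_iff₀ (by positivity)]
  have hle' : ((∑ x ∈ box d L, ((nbrs x).filter (· ∉ box d L)).card : ℕ) : ℝ)
      ≤ ((L : ℝ) ^ d - ((L : ℝ) - 2) ^ d) * 3 ^ d := by
    refine (Nat.cast_le.2 hle).trans (le_of_eq ?_)
    rw [Nat.cast_mul, Nat.cast_sub (Nat.pow_le_pow_left (Nat.sub_le L 2) d), Nat.cast_pow,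
      Nat.cast_pow, Nat.cast_sub hL]
    push_cast
    ring
  refine hle'.trans (le_of_eq ?_)
  rw [one_sub_div hL0.ne', div_pow]
  field_simp

/-- A function whose increments from `0` are bounded below by `a * q L` up to a vanishing error and
above by `a * q k + O(a ^ 2)` has a right derivative, which is the limit of `q`. -/
theorem exists_tendsto_and_hasDerivWithinAt {q : ℕ → ℝ} {m : ℝ → ℝ} {V : ℕ → ℝ}
    (hV : ∀ k, 1 ≤ k → 0 < V k)
    (hlow : ∀ a, 0 ≤ a → ∀ ε, 0 < ε → ∀ᶠ L in atTop, a * q L ≤ m a - m 0 + ε)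
    (hup : ∀ k, 1 ≤ k → ∀ a, 0 ≤ a → a * V k ≤ 1 → m a - m 0 ≤ a * q k + a ^ 2 * V k)
    (hq : ∀ L, 0 ≤ q L) :
    ∃ l, Tendsto q atTop (𝓝 l) ∧ (∀ k, 1 ≤ k → l ≤ q k) ∧
      HasDerivWithinAt m l (Set.Ici 0) 0 := by
  obtain ⟨l, hl, hle⟩ := exists_tendsto_of_eventually_le (a := q) (B := 0) (fun k hk ε hε => by
    have hVk := hV k hk
    -- The first bound makes `hup` applicable, the second makes its quadratic error at most a ε/2;
    -- the other a ε/2 is the error granted to `hlow`.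
    obtain ⟨a, ha0, ha1, ha2⟩ : ∃ a, 0 < a ∧ a * V k ≤ 1 ∧ a * V k ≤ ε / 2 := by
      refine ⟨min 1 (ε / 2) / V k, by positivity, ?_, ?_⟩ <;> rw [div_mul_cancel₀ _ hVk.ne']
      · exact min_le_left _ _
      · exact min_le_right _ _
    filter_upwards [hlow a ha0.le (a * (ε / 2)) (by positivity)] with L hL
    have h1 := hup k hk a ha0.le ha1
    have h2 := mul_le_mul_of_nonneg_left ha2 ha0.le
    refine le_of_mul_le_mul_left ?_ ha0
    nlinarith) fun L _ => hq L
  refine ⟨l, hl, hle, ?_⟩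
  have hlow' : ∀ a, 0 ≤ a → a * l ≤ m a - m 0 := fun a ha =>
    le_of_forall_pos_le_add fun ε hε => le_of_tendsto (hl.const_mul a) (hlow a ha ε hε)
  rw [hasDerivWithinAt_iff_isLittleO, Asymptotics.isLittleO_iff]
  intro c hc
  -- One half of c covers q k - l, the other the quadratic error, since a V k ≤ c/2 for a near 0.
  obtain ⟨k, hkq, hk⟩ := ((hl.eventually_lt_const
    (lt_add_of_pos_right l (half_pos hc))).and (eventually_ge_atTop 1)).exists
  have hVk := hV k hk
  have hδ : 0 < min 1 (c / 2) / V k := by positivity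
  filter_upwards [self_mem_nhdsWithin, nhdsWithin_le_nhds (gt_mem_nhds hδ)] with a ha haδ
  have ha0 : 0 ≤ a := ha
  have ha1 : a * V k ≤ min 1 (c / 2) := (lt_div_iff₀ hVk).1 haδ |>.le
  have h1 := hup k hk a ha0 (ha1.trans (min_le_left _ _))
  have h2 := mul_le_mul_of_nonneg_left (ha1.trans (min_le_right _ _)) ha0
  have h3 := hlow' a ha0
  have h4 := mul_le_mul_of_nonneg_left hkq.le ha0
  rw [sub_zero, Real.norm_of_nonneg ha0, smul_eq_mul, Real.norm_eq_abs, abs_le]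
  have h5 := mul_nonneg hc.le ha0
  constructor <;> nlinarith

/-! ### Random couplings -/

variable {Ω : Type*} [MeasurableSpace Ω]

/-- Random couplings that are integrable, stationary, and independent at separated places. -/
structure IsDisorder (μ : Measure Ω) (X : Ω → Sym2 (Site d) → ℝ) (K : ℝ) : Prop where
  measurable : Measurable X
  integrable : ∀ e, Integrable (fun ω => X ω e) μ
  integral_abs_le : ∀ e, ∫ ω, |X ω e| ∂μ ≤ K
  integral_shift : ∀ v (F : (Sym2 (Site d) → ℝ) → ℝ), Measurable F →
    ∫ ω, F (shift v (X ω)) ∂μ = ∫ ω, F (X ω) ∂μ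
  integral_mul : ∀ (β : ℝ) (A B : Finset (Site d)), Separated A B →
    ∫ ω, maxOverlap β A (X ω) * maxOverlap β B (X ω) ∂μ
      = (∫ ω, maxOverlap β A (X ω) ∂μ) * ∫ ω, maxOverlap β B (X ω) ∂μ

section Construction

variable {μ : Measure Ω} {J : Sym2 (Site d) → Ω → ℝ}

/-- Couplings given on the bonds of the lattice, extended by zero. -/
noncomputable def extendCouplings (c : (lattice d).edgeSet → ℝ) (e : Sym2 (Site d)) : ℝ :=
  open Classical in if h : e ∈ (lattice d).edgeSet then c ⟨e, h⟩ else 0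

theorem measurable_extendCouplings :
    Measurable (extendCouplings : ((lattice d).edgeSet → ℝ) → Sym2 (Site d) → ℝ) := by
  refine measurable_pi_lambda _ fun e => ?_
  unfold extendCouplings
  split_ifs with h
  · exact measurable_pi_apply _
  · exact measurable_const

instance : Countable (Sym2 (Site d)) := by
  unfold Sym2
  infer_instance

theorem map_add_mem_edgeSet {v : Site d} {e : Sym2 (Site d)} :
    e.map (· + v) ∈ (lattice d).edgeSet ↔ e ∈ (lattice d).edgeSet := by
  induction e using Sym2.inductionOn with
  | hf x y => simp

/-- Translation of bonds. -/
def translateBond (v : Site d) (e : (lattice d).edgeSet) : (lattice d).edgeSet :=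
  ⟨e.1.map (· + v), map_add_mem_edgeSet.2 e.2⟩

theorem translateBond_injective (v : Site d) : Function.Injective (translateBond v) := by
  intro e e' h
  have h' := congrArg Subtype.val h
  exact Subtype.ext (Sym2.map.injective (add_left_injective v) h')

theorem shift_extendCouplings (v : Site d) (c : (lattice d).edgeSet → ℝ) :
    shift v (extendCouplings c) = extendCouplings fun e => c (translateBond v e) := by
  funext e
  simp only [shift, extendCouplings, map_add_mem_edgeSet]
  rfl

/-- Translation acts injectively on bonds, so the shifted family is again independent with the same
marginals, and therefore has the same joint law. -/
theorem identDistrib_shift (hindep : iIndepFun (fun e : (lattice d).edgeSet => J e) μ)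
    (hident : ∀ e ∈ (lattice d).edgeSet, ∀ e' ∈ (lattice d).edgeSet,
      IdentDistrib (J e) (J e') μ μ) (v : Site d) :
    IdentDistrib (fun ω => shift v (extendCouplings fun e => J e ω))
      (fun ω => extendCouplings fun e => J e ω) μ μ := by
  have h := IdentDistrib.pi (fun e : (lattice d).edgeSet =>
    hident (translateBond v e) (translateBond v e).2 e e.2)
    (hindep.precomp (translateBond_injective v)) hindep
  have h' := h.comp measurable_extendCouplings
  simp only [shift_extendCouplings]
  exact h'

/-- The bonds with an endpoint in `A`. -/
noncomputable def bondsOf (A : Finset (Site d)) : Finset (lattice d).edgeSet :=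
  open Classical in
  (A.biUnion fun x => (nbrs x).image fun u => s(x, u)).subtype (· ∈ (lattice d).edgeSet)

theorem mem_bondsOf {A : Finset (Site d)} {e : (lattice d).edgeSet} :
    e ∈ bondsOf A ↔ ∃ x ∈ A, ∃ u, (lattice d).Adj x u ∧ s(x, u) = e.1 := by
  simp [bondsOf]

/-- A bond touching both regions would have an endpoint common to both or would join them;
separation excludes either. -/
theorem disjoint_bondsOf {A B : Finset (Site d)} (h : Separated A B) :
    Disjoint (bondsOf A) (bondsOf B) := by
  rw [Finset.disjoint_left]
  intro e hA hB
  obtain ⟨x, hx, u, hxu, he⟩ := mem_bondsOf.1 hA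
  obtain ⟨y, hy, w, hyw, he'⟩ := mem_bondsOf.1 hB
  rw [← he', Sym2.eq_iff] at he
  rcases he with ⟨rfl, -⟩ | ⟨rfl, rfl⟩
  · exact Finset.disjoint_left.1 h.1 hx hy
  · exact h.2 _ hx _ hy hxu

/-- The maximal overlap in `A` as a function of the couplings at the bonds touching `A`. -/
noncomputable def localMaxOverlap (β : ℝ) (A : Finset (Site d)) (c : bondsOf A → ℝ) : ℝ :=
  open Classical in
  maxOverlap β A (extendCouplings fun e => if h : e ∈ bondsOf A then c ⟨e, h⟩ else 0)

theorem measurable_localMaxOverlap (β : ℝ) (A : Finset (Site d)) :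
    Measurable (localMaxOverlap β A) := by
  refine (measurable_maxOverlap β A).comp (measurable_extendCouplings.comp
    (measurable_pi_lambda _ fun e => ?_))
  split_ifs with h
  · exact measurable_pi_apply _
  · exact measurable_const

theorem maxOverlap_extendCouplings (β : ℝ) (A : Finset (Site d)) (c : (lattice d).edgeSet → ℝ) :
    maxOverlap β A (extendCouplings c) = localMaxOverlap β A fun e => c e := by
  refine maxOverlap_congr β fun x hx u hxu => ?_
  have h1 : s(x, u) ∈ (lattice d).edgeSet := hxu
  have h2 : (⟨s(x, u), h1⟩ : (lattice d).edgeSet) ∈ bondsOf A :=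
    mem_bondsOf.2 ⟨x, hx, u, hxu, rfl⟩
  simp only [extendCouplings, h1, h2, dite_true]

theorem exists_isDisorder [IsProbabilityMeasure μ]
    (hmeas : ∀ e ∈ (lattice d).edgeSet, Measurable (J e))
    (hindep : iIndepFun (fun e : (lattice d).edgeSet => J e) μ)
    (hident : ∀ e ∈ (lattice d).edgeSet, ∀ e' ∈ (lattice d).edgeSet,
      IdentDistrib (J e) (J e') μ μ)
    (hint : ∀ e ∈ (lattice d).edgeSet, Integrable (J e) μ) :
    ∃ K, IsDisorder μ (fun ω => extendCouplings fun e : (lattice d).edgeSet => J e ω) K := by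
  -- All bonds share one mean absolute coupling; K = 0 serves when there are no bonds.
  obtain ⟨K, hK0, hK⟩ : ∃ K : ℝ, 0 ≤ K ∧ ∀ e ∈ (lattice d).edgeSet, ∫ ω, |J e ω| ∂μ ≤ K := by
    by_cases hne : (lattice d).edgeSet.Nonempty
    · obtain ⟨e₀, he₀⟩ := hne
      refine ⟨∫ ω, |J e₀ ω| ∂μ, integral_nonneg fun _ => abs_nonneg _, fun e he => ?_⟩
      exact ((hident e he e₀ he₀).comp measurable_abs).integral_eq.le
    · exact ⟨0, le_rfl, fun e he => (hne ⟨e, he⟩).elim⟩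
  have hX : Measurable fun ω => extendCouplings fun e : (lattice d).edgeSet => J e ω :=
    measurable_extendCouplings.comp (measurable_pi_lambda _ fun e => hmeas e e.2)
  refine ⟨K, hX, fun e => ?_, fun e => ?_, fun v F hF => ?_, fun β A B hAB => ?_⟩
  · by_cases he : e ∈ (lattice d).edgeSet
    · simpa [extendCouplings, he] using hint e he
    · simp [extendCouplings, he]
  · by_cases he : e ∈ (lattice d).edgeSet
    · simpa [extendCouplings, he] using hK e he
    · simpa [extendCouplings, he] using hK0
  · exact ((identDistrib_shift hindep hident v).comp hF).integral_eq
  · simp only [maxOverlap_extendCouplings]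
    have h := (hindep.indepFun_finset (bondsOf A) (bondsOf B) (disjoint_bondsOf hAB)
      fun e => hmeas e e.2).comp (measurable_localMaxOverlap β A) (measurable_localMaxOverlap β B)
    have hm : ∀ A : Finset (Site d), Measurable fun ω =>
        localMaxOverlap β A fun e : bondsOf A => J e ω := fun A =>
      (measurable_localMaxOverlap β A).comp (measurable_pi_lambda _ fun e => hmeas e e.1.2)
    exact h.integral_fun_mul_eq_mul_integral (hm A).aestronglyMeasurable
      (hm B).aestronglyMeasurable

end Construction

/-! ### Disorder averages of the maxima -/

namespace IsDisorder

variable {μ : Measure Ω} {X : Ω → Sym2 (Site d) → ℝ} {K : ℝ}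

theorem integrable_sum_abs (h : IsDisorder μ X K) (A : Finset (Site d))
    (N : Site d → Finset (Site d)) :
    Integrable (fun ω => ∑ x ∈ A, ∑ u ∈ N x, |X ω s(x, u)|) μ :=
  integrable_finsetSum _ fun _ _ => integrable_finsetSum _ fun _ _ => (h.integrable _).abs

theorem integral_sum_abs_le (h : IsDisorder μ X K) (A : Finset (Site d))
    (N : Site d → Finset (Site d)) :
    ∫ ω, ∑ x ∈ A, ∑ u ∈ N x, |X ω s(x, u)| ∂μ ≤ K * (∑ x ∈ A, (N x).card : ℕ) := by
  rw [integral_finsetSum _ fun _ _ => integrable_finsetSum _ fun _ _ => (h.integrable _).abs,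
    Nat.cast_sum, Finset.mul_sum]
  refine Finset.sum_le_sum fun x _ => ?_
  rw [integral_finsetSum _ fun _ _ => (h.integrable _).abs, mul_comm, ← nsmul_eq_mul]
  exact Finset.sum_le_card_nsmul _ _ _ fun u _ => h.integral_abs_le _

theorem nonneg (h : IsDisorder μ X K) : 0 ≤ K :=
  (integral_nonneg fun _ => abs_nonneg _).trans (h.integral_abs_le s(0, 0))

theorem integrable_totalCoupling (h : IsDisorder μ X K) (A : Finset (Site d)) :
    Integrable (fun ω => totalCoupling (X ω) A) μ :=
  h.integrable_sum_abs A nbrs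

theorem integral_totalCoupling_le (h : IsDisorder μ X K) (A : Finset (Site d)) :
    ∫ ω, totalCoupling (X ω) A ∂μ ≤ K * 3 ^ d * A.card := by
  refine (h.integral_sum_abs_le A nbrs).trans ?_
  rw [mul_assoc]
  refine mul_le_mul_of_nonneg_left ?_ h.nonneg
  have : ∑ x ∈ A, (nbrs x).card ≤ A.card * 3 ^ d := by
    rw [← smul_eq_mul]
    exact Finset.sum_le_card_nsmul _ _ _ fun x _ => card_nbrs_le x
  rw [mul_comm]
  exact_mod_cast this

theorem integrable_boundaryCoupling (h : IsDisorder μ X K) (A : Finset (Site d)) :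
    Integrable (fun ω => boundaryCoupling (X ω) A) μ :=
  h.integrable_sum_abs A fun x => (nbrs x).filter (· ∉ A)

theorem integral_boundaryCoupling_le (h : IsDisorder μ X K) (A : Finset (Site d)) :
    ∫ ω, boundaryCoupling (X ω) A ∂μ
      ≤ K * (∑ x ∈ A, ((nbrs x).filter (· ∉ A)).card : ℕ) :=
  h.integral_sum_abs_le A fun x => (nbrs x).filter (· ∉ A)

variable {β : ℝ}

theorem integral_maxLogPf_translate (h : IsDisorder μ X K) (a : ℝ) (v : Site d)
    (A : Finset (Site d)) :
    ∫ ω, maxLogPf β a (translate v A) (X ω) ∂μ = ∫ ω, maxLogPf β a A (X ω) ∂μ := by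
  simp only [maxLogPf_translate]
  exact h.integral_shift v _ (measurable_maxLogPf β a A)

theorem integral_maxLogRatio_translate (h : IsDisorder μ X K) (a : ℝ) (v : Site d)
    (A : Finset (Site d)) :
    ∫ ω, maxLogRatio β a (translate v A) (X ω) ∂μ = ∫ ω, maxLogRatio β a A (X ω) ∂μ := by
  simp only [maxLogRatio_translate]
  exact h.integral_shift v _ (measurable_maxLogRatio β a A)

theorem integral_maxOverlap_translate (h : IsDisorder μ X K) (v : Site d)
    (A : Finset (Site d)) :
    ∫ ω, maxOverlap β (translate v A) (X ω) ∂μ = ∫ ω, maxOverlap β A (X ω) ∂μ := by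
  simp only [maxOverlap_translate]
  exact h.integral_shift v _ (measurable_maxOverlap β A)

variable [IsProbabilityMeasure μ]

theorem integrable_maxOverlap (h : IsDisorder μ X K) (A : Finset (Site d)) :
    Integrable (fun ω => maxOverlap β A (X ω)) μ :=
  Integrable.of_bound ((measurable_maxOverlap β A).comp h.measurable).aestronglyMeasurable A.card
    (Eventually.of_forall fun _ => abs_maxOverlap_le)

theorem integrable_maxLogRatio (h : IsDisorder μ X K) (a : ℝ) (A : Finset (Site d)) :
    Integrable (fun ω => maxLogRatio β a A (X ω)) μ :=
  Integrable.of_bound ((measurable_maxLogRatio β a A).comp h.measurable).aestronglyMeasurable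
    (|a| * A.card) (Eventually.of_forall fun _ => abs_maxLogRatio_le)

theorem integrable_bound (h : IsDisorder μ X K) (a : ℝ) (A : Finset (Site d)) :
    Integrable (fun ω => (|a| + 2 * Real.log 2) * A.card + 2 * β * totalCoupling (X ω) A) μ :=
  (integrable_const _).add ((h.integrable_totalCoupling A).const_mul _)

theorem integrable_maxLogPf (h : IsDisorder μ X K) (hβ : 0 ≤ β) (a : ℝ) (A : Finset (Site d)) :
    Integrable (fun ω => maxLogPf β a A (X ω)) μ :=
  (h.integrable_bound a A).mono'
    ((measurable_maxLogPf β a A).comp h.measurable).aestronglyMeasurable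
    (Eventually.of_forall fun _ => abs_maxLogPf_le hβ)

theorem integrable_log_pf (h : IsDisorder μ X K) (hβ : 0 ≤ β) (a : ℝ) (A : Finset (Site d))
    {b : Ω → Site d → ℝ} (hb : Measurable b) (hbc : ∀ ω, IsBC (b ω)) :
    Integrable (fun ω => Real.log (pf β a (X ω) A (b ω) (b ω))) μ :=
  (h.integrable_bound a A).mono'
    (Real.measurable_log.comp (measurable_wsum β h.measurable hb hb A _)).aestronglyMeasurable
    (Eventually.of_forall fun ω => abs_log_pf_le hβ a _ A (hbc ω) (hbc ω))

theorem abs_integral_maxLogPf_le (h : IsDisorder μ X K) (hβ : 0 ≤ β) (a : ℝ)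
    (A : Finset (Site d)) :
    |∫ ω, maxLogPf β a A (X ω) ∂μ|
      ≤ (|a| + 2 * Real.log 2 + 2 * β * (K * 3 ^ d)) * A.card := by
  refine abs_integral_le_integral_abs.trans ?_
  refine (integral_mono (h.integrable_maxLogPf hβ a A).abs (h.integrable_bound a A)
    fun _ => abs_maxLogPf_le hβ).trans ?_
  rw [integral_add (integrable_const _) ((h.integrable_totalCoupling A).const_mul _),
    integral_const, integral_const_mul, probReal_univ, one_smul]
  have := mul_le_mul_of_nonneg_left (h.integral_totalCoupling_le A)
    (mul_nonneg zero_le_two hβ)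
  linarith

theorem integral_maxLogPf_union_le (h : IsDisorder μ X K) (hβ : 0 ≤ β) (a : ℝ)
    {A B : Finset (Site d)} (hAB : Disjoint A B) :
    ∫ ω, maxLogPf β a (A ∪ B) (X ω) ∂μ
      ≤ ∫ ω, maxLogPf β a A (X ω) ∂μ + ∫ ω, maxLogPf β a B (X ω) ∂μ := by
  rw [← integral_add (h.integrable_maxLogPf hβ a A) (h.integrable_maxLogPf hβ a B)]
  exact integral_mono (h.integrable_maxLogPf hβ a _)
    ((h.integrable_maxLogPf hβ a A).add (h.integrable_maxLogPf hβ a B))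
    fun _ => maxLogPf_union_le hβ hAB

theorem integral_maxLogRatio_union_le (h : IsDisorder μ X K) (a : ℝ)
    {A B : Finset (Site d)} (hAB : Disjoint A B) :
    ∫ ω, maxLogRatio β a (A ∪ B) (X ω) ∂μ
      ≤ ∫ ω, maxLogRatio β a A (X ω) ∂μ + ∫ ω, maxLogRatio β a B (X ω) ∂μ := by
  rw [← integral_add (h.integrable_maxLogRatio a A) (h.integrable_maxLogRatio a B)]
  exact integral_mono (h.integrable_maxLogRatio a _)
    ((h.integrable_maxLogRatio a A).add (h.integrable_maxLogRatio a B))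
    fun _ => maxLogRatio_union_le hAB

end IsDisorder

/-! ### Second moment of the overlap -/

theorem ov_mul_ov_le {A B : Finset (Site d)} {s t : Site d → ℝ} (hs : IsBC s) (ht : IsBC t) :
    ov A s t * ov B s t ≤ A.card * B.card := by
  refine (le_abs_self _).trans ?_
  rw [abs_mul]
  exact mul_le_mul (abs_ov_le hs ht) (abs_ov_le hs ht) (abs_nonneg _) (Nat.cast_nonneg _)

/-- The second moment of the overlap in a box, estimated by the maximal overlaps in tiles. -/
theorem wsum_ov_sq_le (β : ℝ) (j : Sym2 (Site d) → ℝ) {k M L : ℕ} (hk : 1 ≤ k) (h : k * M ≤ L)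
    {b c : Site d → ℝ} (hb : IsBC b) (hc : IsBC c) :
    wsum β j (box d L) b c (fun s t => ov (box d L) s t ^ 2)
        / wsum β j (box d L) b c (fun _ _ => 1)
      ≤ ∑ n ∈ tileIndices d M, ∑ m ∈ tileIndices d M,
          (if ∃ i, n i + 2 ≤ m i ∨ m i + 2 ≤ n i
            then maxOverlap β (tile k n) j * maxOverlap β (tile k m) j else ((k : ℝ) ^ d) ^ 2)
        + 2 * (L : ℝ) ^ d * ((L : ℝ) ^ d - ((k * M : ℕ) : ℝ) ^ d) := by
  set r := 2 * (L : ℝ) ^ d * ((L : ℝ) ^ d - ((k * M : ℕ) : ℝ) ^ d) with hr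
  rw [div_le_iff₀ (wsum_pos _ _ _ _ _ fun _ _ => one_pos)]
  have h1 : wsum β j (box d L) b c (fun s t => ov (box d L) s t ^ 2)
      ≤ wsum β j (box d L) b c fun s t =>
        (∑ n ∈ tileIndices d M, ∑ m ∈ tileIndices d M, ov (tile k n) s t * ov (tile k m) s t)
          + r * 1 := by
    refine wsum_mono _ _ _ _ _ fun s t hs ht => ?_
    have e1 : ov (tiles d k M) s t = ∑ n ∈ tileIndices d M, ov (tile k n) s t :=
      sum_tiles k M fun x => s x * t x
    have e2 : ov (box d L) s t
        = ov (box d L \ tiles d k M) s t + ov (tiles d k M) s t :=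
      (Finset.sum_sdiff (tiles_subset_box h)).symm
    have b1 := abs_le.1 (abs_ov_le (A := box d L) hs.isBC ht.isBC)
    have b2 := abs_le.1 (abs_ov_le (A := tiles d k M) hs.isBC ht.isBC)
    have b3 := abs_ov_le (A := box d L \ tiles d k M) hs.isBC ht.isBC
    have hcard : ((tiles d k M).card : ℝ) ≤ (box d L).card :=
      Nat.cast_le.2 (Finset.card_le_card (tiles_subset_box h))
    -- The difference of the squared overlaps of the box and of the tiles is their sum times their
    -- difference; the latter is the overlap on the uncovered sites.
    have b4 : |ov (box d L) s t + ov (tiles d k M) s t| ≤ 2 * (L : ℝ) ^ d := by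
      have e3 : ((box d L).card : ℝ) = (L : ℝ) ^ d := by rw [card_box, Nat.cast_pow]
      rw [e3] at b1 hcard
      rw [abs_le]
      constructor <;> linarith
    rw [card_box_sdiff_tiles h] at b3
    have b5 := mul_le_mul b4 b3 (abs_nonneg _) (by positivity)
    rw [← abs_mul] at b5
    have b6 := (le_abs_self _).trans b5
    rw [← Finset.sum_mul_sum, ← e1, mul_one, hr]
    have e4 : ov (box d L \ tiles d k M) s t = ov (box d L) s t - ov (tiles d k M) s t := by
      linarith
    rw [e4] at b6
    linarith
  refine h1.trans ?_
  rw [wsum_add, wsum_mul_left, add_mul, wsum_sum, Finset.sum_mul]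
  refine add_le_add (Finset.sum_le_sum fun n hn => ?_) le_rfl
  rw [wsum_sum, Finset.sum_mul]
  refine Finset.sum_le_sum fun m hm => ?_
  split_ifs with hnm
  · exact wsum_ov_mul_ov_le β j (separated_tile hk hnm) (tile_subset_box h hn)
      (tile_subset_box h hm) hb hc
  · rw [← wsum_mul_left]
    refine wsum_mono _ _ _ _ _ fun s t hs ht => ?_
    have := ov_mul_ov_le (A := tile k n) (B := tile k m) hs.isBC ht.isBC
    rw [card_tile, card_tile, Nat.cast_pow] at this
    rw [mul_one, sq]
    exact this

/-! ### Thermodynamic limits and the averaged second moment -/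

namespace IsDisorder

variable {μ : Measure Ω} {X : Ω → Sym2 (Site d) → ℝ} {K β : ℝ}
  [IsProbabilityMeasure μ]

theorem card_box_cast_pos {L : ℕ} (hL : 1 ≤ L) : 0 < (L : ℝ) ^ d := by
  have : (0 : ℝ) < L := by exact_mod_cast hL
  positivity

theorem exists_tendsto_integral_maxLogPf (h : IsDisorder μ X K) (hβ : 0 ≤ β) (a : ℝ) :
    ∃ m, Tendsto (fun L : ℕ => (∫ ω, maxLogPf β a (box d L) (X ω) ∂μ) / (L : ℝ) ^ d) atTop
      (𝓝 m) := by
  obtain ⟨m, hm, -⟩ := exists_tendsto_of_eventually_le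
    (subadditive_eventually_le (fun A B => h.integral_maxLogPf_union_le hβ a (A := A) (B := B))
      (h.integral_maxLogPf_translate a)
      fun A => (le_abs_self _).trans (h.abs_integral_maxLogPf_le hβ a A))
    (B := -(|a| + 2 * Real.log 2 + 2 * β * (K * 3 ^ d))) fun L hL => by
      have := (abs_le.1 (h.abs_integral_maxLogPf_le hβ a (box d L))).1
      rw [card_box, Nat.cast_pow] at this
      rw [le_div_iff₀ (card_box_cast_pos hL)]
      linarith
  exact ⟨m, hm⟩

theorem tendsto_boundary (K' : ℝ) (d : ℕ) : Tendsto (fun L : ℕ => K' *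
    (((∑ x ∈ box d L, ((nbrs x).filter (· ∉ box d L)).card : ℕ) : ℝ) / (L : ℝ) ^ d)) atTop
    (𝓝 0) := by
  simpa using tendsto_card_boundary_bonds.const_mul K'

/-- The free energy density does not depend on the boundary condition. -/
theorem tendsto_integral_log_pf (h : IsDisorder μ X K) (hβ : 0 ≤ β) (a : ℝ) {m : ℝ}
    (hm : Tendsto (fun L : ℕ => (∫ ω, maxLogPf β a (box d L) (X ω) ∂μ) / (L : ℝ) ^ d) atTop
      (𝓝 m)) {b : ℕ → Ω → Site d → ℝ} (hb : ∀ L, Measurable (b L)) (hbc : ∀ L ω, IsBC (b L ω)) :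
    Tendsto (fun L : ℕ => (∫ ω, Real.log (pf β a (X ω) (box d L) (b L ω) (b L ω)) ∂μ)
      / (L : ℝ) ^ d) atTop (𝓝 m) := by
  have hlow := hm.sub (tendsto_boundary (4 * β * K) d)
  rw [sub_zero] at hlow
  refine tendsto_of_tendsto_of_tendsto_of_le_of_le' hlow hm ?_ ?_
  · filter_upwards [eventually_ge_atTop 1] with L hL
    rw [← mul_div_assoc, ← sub_div]
    refine div_le_div_of_nonneg_right ?_ (card_box_cast_pos hL).le
    have h1 := integral_mono (h.integrable_maxLogPf hβ a (box d L))
      ((h.integrable_log_pf hβ a (box d L) (hb L) (hbc L)).add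
        ((h.integrable_boundaryCoupling (box d L)).const_mul (4 * β)))
      fun ω => maxLogPf_le hβ (hbc L ω) (hbc L ω)
    simp only [Pi.add_apply] at h1
    rw [integral_add (h.integrable_log_pf hβ a (box d L) (hb L) (hbc L))
      ((h.integrable_boundaryCoupling (box d L)).const_mul (4 * β)), integral_const_mul] at h1
    have h2 := mul_le_mul_of_nonneg_left (h.integral_boundaryCoupling_le (box d L))
      (mul_nonneg zero_le_four hβ)
    linarith
  · filter_upwards [eventually_ge_atTop 1] with L hL
    refine div_le_div_of_nonneg_right ?_ (card_box_cast_pos hL).le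
    exact integral_mono (h.integrable_log_pf hβ a (box d L) (hb L) (hbc L))
      (h.integrable_maxLogPf hβ a (box d L)) fun ω => log_pf_le hβ (hbc L ω) (hbc L ω)

theorem mul_integral_maxOverlap_le (h : IsDisorder μ X K) (hβ : 0 ≤ β) {a : ℝ} (ha : 0 ≤ a)
    (A : Finset (Site d)) :
    a * ∫ ω, maxOverlap β A (X ω) ∂μ
      ≤ ∫ ω, maxLogPf β a A (X ω) ∂μ - ∫ ω, maxLogPf β 0 A (X ω) ∂μ
        + 4 * β * K * (∑ x ∈ A, ((nbrs x).filter (· ∉ A)).card : ℕ) := by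
  have i1 := h.integrable_maxLogPf hβ a A
  have i2 := h.integrable_maxLogPf hβ 0 A
  have i3 := (h.integrable_boundaryCoupling A).const_mul (4 * β)
  have i12 : Integrable (fun ω => maxLogPf β a A (X ω) - maxLogPf β 0 A (X ω)) μ := i1.sub i2
  have h1 := integral_mono ((h.integrable_maxOverlap (β := β) A).const_mul a)
    (i12.add i3) fun ω => mul_maxOverlap_le hβ ha
  simp only [Pi.add_apply] at h1
  rw [integral_add i12 i3, integral_sub i1 i2, integral_const_mul,
    integral_const_mul] at h1
  have h2 := mul_le_mul_of_nonneg_left (h.integral_boundaryCoupling_le A)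
    (mul_nonneg zero_le_four hβ)
  linarith

theorem integral_maxLogPf_sub_le (h : IsDisorder μ X K) (hβ : 0 ≤ β) (a : ℝ)
    (A : Finset (Site d)) :
    ∫ ω, maxLogPf β a A (X ω) ∂μ - ∫ ω, maxLogPf β 0 A (X ω) ∂μ
      ≤ ∫ ω, maxLogRatio β a A (X ω) ∂μ := by
  rw [← integral_sub (h.integrable_maxLogPf hβ a A) (h.integrable_maxLogPf hβ 0 A)]
  exact integral_mono ((h.integrable_maxLogPf hβ a A).sub (h.integrable_maxLogPf hβ 0 A))
    (h.integrable_maxLogRatio a A) fun _ => maxLogPf_sub_le hβ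

theorem integral_maxLogRatio_le (h : IsDisorder μ X K) {a : ℝ} (ha : 0 ≤ a)
    {A : Finset (Site d)} (haA : a * A.card ≤ 1) :
    ∫ ω, maxLogRatio β a A (X ω) ∂μ
      ≤ a * ∫ ω, maxOverlap β A (X ω) ∂μ + (a * A.card) ^ 2 := by
  have h1 := integral_mono (h.integrable_maxLogRatio (β := β) a A)
    (((h.integrable_maxOverlap A).const_mul a).add (integrable_const ((a * A.card) ^ 2)))
    fun _ => maxLogRatio_le ha haA
  simp only [Pi.add_apply] at h1
  rwa [integral_add ((h.integrable_maxOverlap A).const_mul a) (integrable_const _),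
    integral_const_mul, integral_const, probReal_univ, one_smul] at h1

theorem integral_maxLogRatio_eventually_le (h : IsDisorder μ X K) (a : ℝ) {k : ℕ} (hk : 1 ≤ k)
    {ε : ℝ} (hε : 0 < ε) :
    ∀ᶠ L : ℕ in atTop, (∫ ω, maxLogRatio β a (box d L) (X ω) ∂μ) / (L : ℝ) ^ d
      ≤ (∫ ω, maxLogRatio β a (box d k) (X ω) ∂μ) / (k : ℝ) ^ d + ε := by
  refine subadditive_eventually_le (φ := fun A => ∫ ω, maxLogRatio β a A (X ω) ∂μ)
    (fun A B => h.integral_maxLogRatio_union_le a)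
    (h.integral_maxLogRatio_translate a) (C := |a|) (fun A => ?_) k hk ε hε
  have := integral_mono (h.integrable_maxLogRatio (β := β) a A)
    (integrable_const (|a| * A.card)) fun _ => le_of_abs_le abs_maxLogRatio_le
  simpa using this

/-- The overlap density is the right derivative at zero of the limiting log-partition function. -/
theorem exists_overlap_limit (h : IsDisorder μ X K) (hβ : 0 ≤ β) {m : ℝ → ℝ}
    (hm : ∀ a, Tendsto (fun L : ℕ => (∫ ω, maxLogPf β a (box d L) (X ω) ∂μ) / (L : ℝ) ^ d) atTop
      (𝓝 (m a))) :
    ∃ l, Tendsto (fun L : ℕ => (∫ ω, maxOverlap β (box d L) (X ω) ∂μ) / (L : ℝ) ^ d) atTop (𝓝 l) ∧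
      (∀ k : ℕ, 1 ≤ k → l ≤ (∫ ω, maxOverlap β (box d k) (X ω) ∂μ) / (k : ℝ) ^ d) ∧
      HasDerivWithinAt m l (Set.Ici 0) 0 := by
  refine exists_tendsto_and_hasDerivWithinAt (V := fun k => (k : ℝ) ^ d)
    (fun k hk => card_box_cast_pos hk) (fun a ha ε hε => ?_) (fun k hk a ha hak => ?_)
    fun L => div_nonneg (integral_nonneg fun _ => maxOverlap_nonneg) (by positivity)
  · have hlim := ((hm a).sub (hm 0)).add (tendsto_boundary (4 * β * K) d)
    rw [add_zero] at hlim
    filter_upwards [hlim.eventually_le_const (lt_add_of_pos_right _ hε),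
      eventually_ge_atTop 1] with L hL hL1
    refine le_trans ?_ hL
    rw [← mul_div_assoc, ← mul_div_assoc, ← sub_div, ← add_div]
    exact div_le_div_of_nonneg_right (h.mul_integral_maxOverlap_le hβ ha _)
      (card_box_cast_pos hL1).le
  · have hkd : (0 : ℝ) < (k : ℝ) ^ d := card_box_cast_pos hk
    have hcard : ((box d k).card : ℝ) = (k : ℝ) ^ d := by rw [card_box, Nat.cast_pow]
    have h1 := h.integral_maxLogRatio_le (β := β) (A := box d k) ha (by rwa [hcard])
    rw [hcard] at h1
    have h2 : (∫ ω, maxLogRatio β a (box d k) (X ω) ∂μ) / (k : ℝ) ^ d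
        ≤ a * ((∫ ω, maxOverlap β (box d k) (X ω) ∂μ) / (k : ℝ) ^ d) + a ^ 2 * (k : ℝ) ^ d := by
      rw [div_le_iff₀ hkd]
      refine h1.trans (le_of_eq ?_)
      field_simp
    -- Subadditivity of R_a carries the estimate from the fixed box of side k to the limit L → ∞.
    refine le_of_forall_pos_le_add fun ε hε => le_of_tendsto ((hm a).sub (hm 0)) ?_
    filter_upwards [h.integral_maxLogRatio_eventually_le (β := β) a hk hε,
      eventually_ge_atTop 1] with L hL hL1
    rw [← sub_div]
    have h3 := div_le_div_of_nonneg_right (h.integral_maxLogPf_sub_le hβ a (box d L))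
      (card_box_cast_pos (d := d) hL1).le
    linarith

/-- For distant tiles independence and stationarity give the squared mean; each of the M^d tiles has
at most 3^d near ones, for which the trivial bound is kept. -/
theorem integral_maxOverlap_mul_le (h : IsDisorder μ X K) {k M : ℕ} (hk : 1 ≤ k) :
    ∫ ω, ∑ n ∈ tileIndices d M, ∑ m ∈ tileIndices d M,
        (if ∃ i, n i + 2 ≤ m i ∨ m i + 2 ≤ n i
          then maxOverlap β (tile k n) (X ω) * maxOverlap β (tile k m) (X ω)
          else ((k : ℝ) ^ d) ^ 2) ∂μ
      ≤ ((M : ℝ) ^ d * ∫ ω, maxOverlap β (box d k) (X ω) ∂μ) ^ 2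
        + (M : ℝ) ^ d * (3 ^ d * ((k : ℝ) ^ d) ^ 2) := by
  have hint : ∀ n m : Fin d → ℕ, Integrable (fun ω => if ∃ i, n i + 2 ≤ m i ∨ m i + 2 ≤ n i
      then maxOverlap β (tile k n) (X ω) * maxOverlap β (tile k m) (X ω)
      else ((k : ℝ) ^ d) ^ 2) μ := by
    intro n m
    split_ifs
    · exact (h.integrable_maxOverlap _).mul_bdd (c := (tile k m).card)
        ((measurable_maxOverlap β _).comp h.measurable).aestronglyMeasurable
        (Eventually.of_forall fun _ => abs_maxOverlap_le)
    · exact integrable_const _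
  set Q := ∫ ω, maxOverlap β (box d k) (X ω) ∂μ with hQ
  have htile : ∀ n : Fin d → ℕ, ∫ ω, maxOverlap β (tile k n) (X ω) ∂μ = Q :=
    fun n => h.integral_maxOverlap_translate _ _
  have hterm : ∀ n m : Fin d → ℕ, ∫ ω, (if ∃ i, n i + 2 ≤ m i ∨ m i + 2 ≤ n i
      then maxOverlap β (tile k n) (X ω) * maxOverlap β (tile k m) (X ω)
      else ((k : ℝ) ^ d) ^ 2) ∂μ
      ≤ Q ^ 2 + if ¬ ∃ i, n i + 2 ≤ m i ∨ m i + 2 ≤ n i then ((k : ℝ) ^ d) ^ 2 else 0 := by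
    intro n m
    by_cases hnm : ∃ i, n i + 2 ≤ m i ∨ m i + 2 ≤ n i
    · simp only [hnm, if_true, not_true, if_false, add_zero]
      rw [h.integral_mul β _ _ (separated_tile hk hnm), htile, htile, sq]
    · simp only [hnm, if_false, not_false_eq_true, if_true, integral_const, probReal_univ,
        one_smul]
      linarith [sq_nonneg Q]
  rw [integral_finsetSum _ fun n _ => integrable_finsetSum _ fun m _ => hint n m]
  have hrow : ∀ n ∈ tileIndices d M, ∫ ω, ∑ m ∈ tileIndices d M,
      (if ∃ i, n i + 2 ≤ m i ∨ m i + 2 ≤ n i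
        then maxOverlap β (tile k n) (X ω) * maxOverlap β (tile k m) (X ω)
        else ((k : ℝ) ^ d) ^ 2) ∂μ
      ≤ (M : ℝ) ^ d * Q ^ 2 + 3 ^ d * ((k : ℝ) ^ d) ^ 2 := by
    intro n _
    rw [integral_finsetSum _ fun m _ => hint n m]
    refine (Finset.sum_le_sum fun m _ => hterm n m).trans ?_
    rw [Finset.sum_add_distrib, Finset.sum_const, card_tileIndices, nsmul_eq_mul, Nat.cast_pow,
      ← Finset.sum_filter, Finset.sum_const, nsmul_eq_mul]
    refine add_le_add le_rfl (mul_le_mul_of_nonneg_right ?_ (by positivity))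
    exact_mod_cast card_near_le M n
  refine (Finset.sum_le_sum hrow).trans (le_of_eq ?_)
  rw [Finset.sum_const, card_tileIndices, nsmul_eq_mul, Nat.cast_pow]
  ring

theorem integral_ov_sq_le (h : IsDisorder μ X K) {k M L : ℕ} (hk : 1 ≤ k) (hL : 1 ≤ L)
    (hM : k * M ≤ L) {b c : Site d → ℝ} (hb : IsBC b) (hc : IsBC c) :
    ∫ ω, (((L : ℝ) ^ d) ^ 2)⁻¹ * (wsum β (X ω) (box d L) b c (fun s t => ov (box d L) s t ^ 2)
        / wsum β (X ω) (box d L) b c fun _ _ => 1) ∂μ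
      ≤ ((∫ ω, maxOverlap β (box d k) (X ω) ∂μ) / (k : ℝ) ^ d) ^ 2
        + 3 ^ d * (k : ℝ) ^ d / (L : ℝ) ^ d + 2 * (1 - (((k * M : ℕ) : ℝ) / L) ^ d) := by
  set Q := ∫ ω, maxOverlap β (box d k) (X ω) ∂μ with hQ
  have hLd : (0 : ℝ) < (L : ℝ) ^ d := card_box_cast_pos hL
  have hkd : (0 : ℝ) < (k : ℝ) ^ d := card_box_cast_pos hk
  have hint : Integrable (fun ω => ∑ n ∈ tileIndices d M, ∑ m ∈ tileIndices d M,
      (if ∃ i, n i + 2 ≤ m i ∨ m i + 2 ≤ n i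
        then maxOverlap β (tile k n) (X ω) * maxOverlap β (tile k m) (X ω)
        else ((k : ℝ) ^ d) ^ 2)) μ := by
    refine integrable_finsetSum _ fun n _ => integrable_finsetSum _ fun m _ => ?_
    split_ifs
    · exact (h.integrable_maxOverlap _).mul_bdd (c := (tile k m).card)
        ((measurable_maxOverlap β _).comp h.measurable).aestronglyMeasurable
        (Eventually.of_forall fun _ => abs_maxOverlap_le)
    · exact integrable_const _
  rw [integral_const_mul]
  have h1 : ∫ ω, wsum β (X ω) (box d L) b c (fun s t => ov (box d L) s t ^ 2)
        / wsum β (X ω) (box d L) b c (fun _ _ => 1) ∂μ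
      ≤ ((M : ℝ) ^ d * Q) ^ 2 + (M : ℝ) ^ d * (3 ^ d * ((k : ℝ) ^ d) ^ 2)
        + 2 * (L : ℝ) ^ d * ((L : ℝ) ^ d - ((k * M : ℕ) : ℝ) ^ d) := by
    -- This form of monotonicity requires integrability of the upper bound only.
    refine (integral_mono_of_nonneg (Eventually.of_forall fun ω => ?_)
      (hint.add (integrable_const (2 * (L : ℝ) ^ d * ((L : ℝ) ^ d - ((k * M : ℕ) : ℝ) ^ d))))
      (Eventually.of_forall fun ω => wsum_ov_sq_le β (X ω) hk hM hb hc)).trans ?_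
    · refine div_nonneg ?_ (wsum_pos _ _ _ _ _ fun _ _ => one_pos).le
      -- The constant 0 is written as 0 * 1 so that `wsum_mul_left` can extract the zero factor.
      have := wsum_mono β (X ω) (box d L) b c (F := fun _ _ => 0 * 1)
        (G := fun s t => ov (box d L) s t ^ 2) fun s t _ _ => by
          simpa using sq_nonneg (ov (box d L) s t)
      rwa [wsum_mul_left, zero_mul] at this
    · simp only [Pi.add_apply]
      rw [integral_add hint (integrable_const _), integral_const, probReal_univ, one_smul]
      exact add_le_add (h.integral_maxOverlap_mul_le hk) le_rfl
  have hMk : (M : ℝ) ^ d * (k : ℝ) ^ d ≤ (L : ℝ) ^ d := by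
    rw [← mul_pow]
    refine pow_le_pow_left₀ (by positivity) ?_ d
    rw [mul_comm]
    exact_mod_cast hM
  rw [inv_mul_le_iff₀ (by positivity)]
  refine h1.trans ?_
  have e1 : ((L : ℝ) ^ d) ^ 2 * ((Q / (k : ℝ) ^ d) ^ 2 + 3 ^ d * (k : ℝ) ^ d / (L : ℝ) ^ d
      + 2 * (1 - (((k * M : ℕ) : ℝ) / L) ^ d))
      = ((L : ℝ) ^ d * (Q / (k : ℝ) ^ d)) ^ 2 + (L : ℝ) ^ d * (3 ^ d * (k : ℝ) ^ d)
        + 2 * (L : ℝ) ^ d * ((L : ℝ) ^ d - ((k * M : ℕ) : ℝ) ^ d) := by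
    rw [div_pow ((k * M : ℕ) : ℝ)]
    field_simp
  rw [e1]
  have hQ0 : 0 ≤ Q := integral_nonneg fun _ => maxOverlap_nonneg
  refine add_le_add (add_le_add (pow_le_pow_left₀ (by positivity) ?_ 2) ?_) le_rfl
  · rw [← mul_div_assoc, le_div_iff₀ hkd]
    nlinarith [mul_le_mul_of_nonneg_right hMk hQ0]
  · have := mul_le_mul_of_nonneg_right hMk (show (0 : ℝ) ≤ 3 ^ d * (k : ℝ) ^ d by positivity)
    linarith

end IsDisorder

end EdwardsAnderson

/-! ### Assembly -/

theorem theorem1 {d : ℕ} (hd : 1 ≤ d) {Ω : Type*} [MeasurableSpace Ω]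
    (μ : Measure Ω) [IsProbabilityMeasure μ]
    (J : Sym2 (Site d) → Ω → ℝ)
    (hmeas : ∀ e ∈ (lattice d).edgeSet, Measurable (J e))
    (hindep : iIndepFun (fun e : (lattice d).edgeSet => J e) μ)
    (hident : ∀ e ∈ (lattice d).edgeSet, ∀ e' ∈ (lattice d).edgeSet,
      IdentDistrib (J e) (J e') μ μ)
    (hint : ∀ e ∈ (lattice d).edgeSet, Integrable (J e) μ)
    (β : ℝ) (hβ : 0 < β) :
    ∃ qEA : ℝ,
      Tendsto (fun L : ℕ => qEAFinite μ J β L) atTop (𝓝 qEA) ∧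
      (∃ f₂ : ℝ → ℝ,
        (∀ b : (L : ℕ) → Ω → BoundaryConfig (box d L), (∀ L, Measurable (b L)) →
          ∀ lam : ℝ, Tendsto (fun L : ℕ => freeEnergy₂ μ J β lam L (b L)) atTop (𝓝 (f₂ lam))) ∧
        HasDerivWithinAt f₂ (-qEA) (Set.Ici 0) 0) ∧
      qBr μ J β ≤ qEA := by
  obtain ⟨K, hX⟩ := exists_isDisorder hmeas hindep hident hint
  set X : Ω → Sym2 (Site d) → ℝ :=
    fun ω => extendCouplings fun e : (lattice d).edgeSet => J e ω with hXdef
  have hJX : ∀ ω, ∀ e ∈ (lattice d).edgeSet, J e ω = X ω e := fun ω e he => by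
    simp only [hXdef, extendCouplings, he, dite_true]
  choose m hm using hX.exists_tendsto_integral_maxLogPf hβ.le
  obtain ⟨l, hl, hle, hderiv⟩ := hX.exists_overlap_limit hβ.le hm
  -- The replica coupling in the exponent is a = βλ, so the factor β from the chain rule cancels the
  -- prefactor 1/β.
  refine ⟨l, ?_, ⟨fun lam => -(1 / β) * m (β * lam), fun b hb lam => ?_, ?_⟩, ?_⟩
  · refine hl.congr fun L => ?_
    have : ∀ ω, ⨆ b : BoundaryConfig (box d L), gibbs₂ β 0 (fun e => J e ω) b overlap
        = ((L : ℝ) ^ d)⁻¹ * maxOverlap β (box d L) (X ω) := fun ω => by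
      simp only [gibbs₂_congr (hJX ω)]
      rw [iSup_gibbs₂_overlap, card_box, Nat.cast_pow]
    rw [qEAFinite]
    simp only [this]
    rw [integral_const_mul, div_eq_inv_mul]
  · have h1 := (hX.tendsto_integral_log_pf hβ.le (β * lam) (hm _)
      (b := fun L ω => extBC (b L ω)) (fun L => measurable_extBC.comp (hb L))
      fun L ω => isBC_extBC _).const_mul (-(1 / β))
    refine h1.congr fun L => ?_
    have : ∀ ω, partition₂ β lam (fun e => J e ω) (b L ω)
        = pf β (β * lam) (X ω) (box d L) (extBC (b L ω)) (extBC (b L ω)) := fun ω => by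
      rw [partition₂_congr (hJX ω), partition₂_eq]
    rw [freeEnergy₂]
    simp only [this]
    rw [← one_div_mul_one_div]
    ring
  · have h1 : HasDerivWithinAt (fun lam : ℝ => β * lam) β (Set.Ici 0) 0 := by
      simpa using ((hasDerivAt_id (0 : ℝ)).const_mul β).hasDerivWithinAt
    have h2 : HasDerivWithinAt m l (Set.Ici 0) (β * 0) := by rwa [mul_zero]
    have h3 := (h2.comp (0 : ℝ) h1 fun x hx => mul_nonneg hβ.le hx).const_mul (-(1 / β))
    have e : -(1 / β) * (l * β) = -l := by field_simp
    rwa [e] at h3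
  -- It suffices to bound q_br by the order parameter q of a fixed box of side k, whose limit in k
  -- is l.
  · refine ge_of_tendsto hl ?_
    filter_upwards [eventually_ge_atTop 1] with k hk
    set q := (∫ ω, maxOverlap β (box d k) (X ω) ∂μ) / (k : ℝ) ^ d with hq
    have hq0 : 0 ≤ q :=
      div_nonneg (integral_nonneg fun _ => maxOverlap_nonneg) (by positivity)
    have hlim : Tendsto (fun L : ℕ => √(q ^ 2 + 3 ^ d * (k : ℝ) ^ d / (L : ℝ) ^ d
        + 2 * (1 - (((k * (L / k) : ℕ) : ℝ) / L) ^ d))) atTop (𝓝 q) := by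
      -- The contribution of near tiles vanishes because d ≥ 1.
      have h1 : Tendsto (fun L : ℕ => 3 ^ d * (k : ℝ) ^ d / (L : ℝ) ^ d) atTop (𝓝 0) :=
        tendsto_const_nhds.div_atTop
          ((tendsto_pow_atTop (by omega)).comp tendsto_natCast_atTop_atTop)
      have h2 := ((tendsto_const_nhds (x := (1 : ℝ))).sub
        ((tendsto_mul_div_div hk).pow d)).const_mul 2
      have h3 := ((tendsto_const_nhds (x := q ^ 2)).add h1).add h2 |>.sqrt
      simpa [Real.sqrt_sq hq0] using h3
    rw [qBr, ← hlim.limsup_eq]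
    -- Real-valued limsups need boundedness: the square roots are bounded below by 0, and the upper
    -- sequence converges.
    refine limsup_le_limsup ?_ (isCoboundedUnder_le_of_le atTop (x := 0)
      fun _ => Real.sqrt_nonneg _) hlim.isBoundedUnder_le
    filter_upwards [eventually_ge_atTop 1] with L hL
    refine Real.sqrt_le_sqrt ?_
    have := hX.integral_ov_sq_le (β := β) hk hL (Nat.mul_div_le L k)
      (isBC_extBC (openBoundary (box d L))) (isBC_extBC (openBoundary (box d L)))
    refine le_trans (le_of_eq ?_) this
    refine integral_congr_ae (Eventually.of_forall fun ω => ?_)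
    beta_reduce
    rw [gibbs₂_congr (hJX ω), gibbs₂_overlap_sq, card_box, Nat.cast_pow]
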